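/- Theorem 1.3. Let $p$ be a prime and let $c,d$ be odd positive integers such that $p\nmid cd$, $c$ is cube-free, $d$ is square-free and $\gcd(c,d)=1$. Put $l=\gcd(cd,p-1)$, $m=\gcd(d,p-1)$, $s=\gcd(cd,p+1)$ and $Q=\mathbb Z_{cd}\times\mathbb Z_d$, and let $\tau(n)$ denote the number of positive divisors of $n$. Split extensions are counted up to isomorphism of groups. A subgroup of $\mathrm{GL}(2,p)$ is called reducible if it leaves invariant a one-dimensional subspace of $\mathbb F_p^2$. (i) For every $t\mid lm$ the group $Q$ has a subgroup $H(t)$ of order $t$, and any two subgroups of $Q$ of the same order are isomorphic. Let $N_{red}(H(t))$ denote the number of conjugacy classes in $\mathrm{GL}(2,p)$ of reducible subgroups of $\mathrm{GL}(2,p)$ isomorphic to $H(t)$. Then the number of isomorphism classes of split extensions of $\mathbb Z_p\times\mathbb Z_p$ by $Q$ (groups of the form $(\mathbb Z_p\times\mathbb Z_p)\rtimes Q$) is $$\sum_{t\mid lm} N_{red}(H(t))+\Omega(s,l),\qquad \Omega(s,l)=\begin{cases}0 & \text{if } s=1,\\ \tau(l)(\tau(s)-1) & \text{otherwise.}\end{cases}$$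 (ii) For every positive integer $\alpha$, the number of isomorphism classes of split extensions of $\mathbb Z_{p^\alpha}$ by $Q$ is $\tau(l)$. -/

import Mathlib

/-- `G` is a split extension of `N` by `Q`: there is a short exact sequence
`1 → N → G → Q → 1` with a section `Q → G` that is a group homomorphism. -/
def IsSplitExtension (N Q G : Type) [Group N] [Group Q] [Group G] : Prop :=
  ∃ S : GroupExtension N G Q, Nonempty S.Splitting

/-- Isomorphism of groups, as an equivalence relation on the split extensions of `N` by `Q`. -/
def splitExtensionSetoid (N Q : Type) [Group N] [Group Q] :
    Setoid {G : GrpCat.{0} // IsSplitExtension N Q G} where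
  r G₁ G₂ := Nonempty ((G₁ : GrpCat.{0}) ≃* (G₂ : GrpCat.{0}))
  iseqv :=
    { refl := fun _ => ⟨MulEquiv.refl _⟩
      symm := fun ⟨e⟩ => ⟨e.symm⟩
      trans := fun ⟨e⟩ ⟨f⟩ => ⟨e.trans f⟩ }

/-- The number of isomorphism classes of split extensions of `N` by `Q`. -/
noncomputable def numSplitExtensions (N Q : Type) [Group N] [Group Q] : ℕ :=
  Nat.card (Quotient (splitExtensionSetoid N Q))

/-- A subgroup `K` of `GL(2, p)` is reducible if it leaves invariant a nonzero proper subspace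
of the natural module. -/
def IsReducibleSubgroup {p : ℕ} (K : Subgroup (GL (Fin 2) (ZMod p))) : Prop :=
  ∃ W : Submodule (ZMod p) (Fin 2 → ZMod p), W ≠ ⊥ ∧ W ≠ ⊤ ∧
    ∀ g ∈ K, ∀ v ∈ W, (g : Matrix (Fin 2) (Fin 2) (ZMod p)).mulVec v ∈ W

/-- The reducible subgroups of `GL(2, p)` that are isomorphic to `H`. -/
def ReducibleCopies (p : ℕ) (H : Type) [Group H] : Type :=
  {K : Subgroup (GL (Fin 2) (ZMod p)) // IsReducibleSubgroup K ∧ Nonempty (K ≃* H)}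

/-- Two reducible copies of `H` are equivalent when they are conjugate in `GL(2, p)`. -/
def reducibleCopiesSetoid (p : ℕ) (H : Type) [Group H] : Setoid (ReducibleCopies p H) where
  r K₁ K₂ := ∃ g : GL (Fin 2) (ZMod p), K₂.1 = K₁.1.map (MulAut.conj g).toMonoidHom
  iseqv :=
    { refl := fun K => ⟨1, by ext x; simp⟩
      symm := by
        rintro K₁ K₂ ⟨g, hg⟩
        refine ⟨g⁻¹, ?_⟩
        rw [hg, Subgroup.map_map]
        ext x
        simp [mul_assoc]
      trans := by
        rintro K₁ K₂ K₃ ⟨g, hg⟩ ⟨h, hh⟩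
        refine ⟨h * g, ?_⟩
        rw [hh, hg, Subgroup.map_map]
        ext x
        simp [mul_assoc] }

/-- `N_red(H)`: the number of conjugacy classes of reducible subgroups of `GL(2, p)` that are
isomorphic to `H`. -/
noncomputable def Nred (p : ℕ) (H : Type) [Group H] : ℕ :=
  Nat.card (Quotient (reducibleCopiesSetoid p H))

/-- `τ(n)`, the number of divisors of `n`. -/
def tau (n : ℕ) : ℕ := n.divisors.card

/-- `Ω(s, l)`. -/
def Omega (s l : ℕ) : ℕ := if s = 1 then 0 else tau l * (tau s - 1)

/-- The cyclic group of order `n`, written multiplicatively. -/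
abbrev Cyc (n : ℕ) : Type := Multiplicative (ZMod n)

/-!
Let `Q` be a group of order prime to that of the abelian group `N`. An isomorphism between
`N ⋊[φ] Q` and `N ⋊[ψ] Q` preserves `N`, and it exists exactly when `φ` and `ψ` agree up to
`Aut Q` and conjugation in `Aut N`. The group `Q = ℤ_{cd} × ℤ_d` is `ℤ_c × ℤ_d²`, with `ℤ_c` cyclic
and `ℤ_d²` semisimple, so a homomorphism out of `Q` is determined by its image up to `Aut Q`.
Hence split extensions of `N` by `Q` correspond to conjugacy classes of those subgroups of `Aut N`
that are images of `Q`.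

For `N = ℤ_p²` the images of `Q` in `GL(2, p)` have order prime to `p`. A reducible one is therefore
diagonalizable, with exponent dividing `p - 1`; it is isomorphic to a subgroup of `Q` and determined
up to isomorphism by its order, which divides `lm`. An irreducible one is cyclic by Schur's lemma,
generated by an element with irreducible characteristic polynomial. Up to conjugacy there is exactly
one such subgroup of each order dividing `p² - 1` but not `p - 1`, since elements of equal order of
`𝔽_{p²}` are powers of each other and matrices with the same irreducible characteristic polynomial
are conjugate. The admissible orders are the divisors of `gcd(cd, p² - 1) = ls` that do not
divide `l`.

For `N = ℤ_{p^α}` the group `Aut N` is cyclic, or a `2`-group and then `Q` acts trivially.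
-/

open SemidirectProduct

/-! ### Counting conjugacy classes of subgroups -/

/-- Conjugacy of subgroups of `A`, in the form in which the definition of `Nred` states it. -/
def subgroupConjSetoid (A : Type*) [Group A] : Setoid (Subgroup A) where
  r K L := ∃ g : A, L = K.map (MulAut.conj g).toMonoidHom
  iseqv :=
    { refl := fun K => ⟨1, by ext x; simp⟩
      symm := by
        rintro K _ ⟨g, rfl⟩
        refine ⟨g⁻¹, ?_⟩
        rw [Subgroup.map_map]
        ext x
        simp [mul_assoc]
      trans := by
        rintro K _ _ ⟨g, rfl⟩ ⟨h, rfl⟩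
        refine ⟨h * g, ?_⟩
        rw [Subgroup.map_map]
        ext x
        simp [mul_assoc] }

/-- The number of conjugacy classes of subgroups of `A` that meet `S`. It is meant for sets `S`
that meet only finitely many classes, as `Set.ncard` vanishes on infinite sets. -/
noncomputable def numConjClasses {A : Type*} [Group A] (S : Set (Subgroup A)) : ℕ :=
  (Quotient.mk (subgroupConjSetoid A) '' S).ncard

theorem ncard_range_eq_ncard_range {α β γ : Type*} {f : α → β} {g : α → γ}
    (h : ∀ a b, f a = f b ↔ g a = g b) : (Set.range f).ncard = (Set.range g).ncard := by
  rw [← Nat.card_coe_set_eq, ← Nat.card_coe_set_eq]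
  exact Nat.card_congr ((Setoid.quotientKerEquivRange f).symm.trans
    ((Quotient.congrRight fun a b => h a b).trans (Setoid.quotientKerEquivRange g)))

theorem Nred_eq_numConjClasses (p : ℕ) (H : Type) [Group H] :
    Nred p H = numConjClasses
      {K : Subgroup (GL (Fin 2) (ZMod p)) | IsReducibleSubgroup K ∧ Nonempty (K ≃* H)} := by
  let f : ReducibleCopies p H → Quotient (reducibleCopiesSetoid p H) := Quotient.mk _
  let g : ReducibleCopies p H → Quotient (subgroupConjSetoid (GL (Fin 2) (ZMod p))) :=
    fun K => Quotient.mk _ K.1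
  have hfg : (Set.range f).ncard = (Set.range g).ncard :=
    ncard_range_eq_ncard_range fun K L =>
      Quotient.eq.trans (Quotient.eq (r := subgroupConjSetoid _)).symm
  rw [Quotient.mk_surjective.range_eq, Set.ncard_univ] at hfg
  rw [Nred, hfg, numConjClasses, Set.image_eq_range]
  rfl

section ConjClasses

variable {A : Type*} [Group A]

/-- The common order of the subgroups in a conjugacy class. -/
noncomputable def conjClassCard : Quotient (subgroupConjSetoid A) → ℕ :=
  Quotient.lift (fun K => Nat.card K) <| by
    rintro K _ ⟨g, rfl⟩
    exact (Subgroup.card_map_of_injective (MulAut.conj g).injective).symm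

theorem numConjClasses_eq_add [Finite A] (S : Set (Subgroup A)) {R : Subgroup A → Prop}
    (hR : ∀ K g, R K → R (K.map (MulAut.conj g).toMonoidHom)) :
    numConjClasses S = numConjClasses {K ∈ S | R K} + numConjClasses {K ∈ S | ¬R K} := by
  have hS : S = {K ∈ S | R K} ∪ {K ∈ S | ¬R K} := by
    ext K
    simp only [Set.mem_union, Set.mem_ofPred_eq]
    tauto
  rw [numConjClasses, numConjClasses, numConjClasses, ← Set.ncard_union_eq ?_, ← Set.image_union,
    ← hS]
  rw [Set.disjoint_left]
  rintro _ ⟨K, hK, rfl⟩ ⟨L, hL, h⟩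
  obtain ⟨g, rfl⟩ := Quotient.exact h.symm
  exact hL.2 (hR K g hK.2)

theorem numConjClasses_eq_sum_card [Finite A] {S : Set (Subgroup A)} {T : Finset ℕ}
    (hT : ∀ K ∈ S, Nat.card K ∈ T) :
    numConjClasses S = ∑ t ∈ T, numConjClasses {K ∈ S | Nat.card K = t} := by
  classical
  have hS := Set.toFinite (Quotient.mk (subgroupConjSetoid A) '' S)
  have hmaps : ∀ x ∈ hS.toFinset, conjClassCard x ∈ T := by
    intro x hx
    obtain ⟨K, hK, rfl⟩ := hS.mem_toFinset.1 hx
    exact hT K hK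
  rw [numConjClasses, Set.ncard_eq_toFinset_card _ hS, Finset.card_eq_sum_card_fiberwise hmaps]
  refine Finset.sum_congr rfl fun t _ => ?_
  rw [numConjClasses, ← Set.ncard_coe_finset]
  congr 1
  ext x
  simp only [Finset.coe_filter, Set.Finite.mem_toFinset, Set.mem_ofPred_eq]
  constructor
  · rintro ⟨⟨K, hK, rfl⟩, hKt⟩
    exact ⟨K, ⟨hK, hKt⟩, rfl⟩
  · rintro ⟨K, ⟨hK, hKt⟩, rfl⟩
    exact ⟨⟨K, hK, rfl⟩, hKt⟩

theorem numConjClasses_eq_card {S : Set (Subgroup A)} {T : Finset ℕ}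
    (hconj : ∀ K ∈ S, ∀ L ∈ S, Nat.card K = Nat.card L →
      ∃ g : A, L = K.map (MulAut.conj g).toMonoidHom)
    (hT : ∀ t, t ∈ T ↔ ∃ K ∈ S, Nat.card K = t) : numConjClasses S = T.card := by
  have hinj : Set.InjOn conjClassCard (Quotient.mk (subgroupConjSetoid A) '' S) := by
    rintro _ ⟨K, hK, rfl⟩ _ ⟨L, hL, rfl⟩ h
    exact Quotient.sound (hconj K hK L hL h)
  rw [numConjClasses, ← hinj.ncard_image, ← Set.ncard_coe_finset, Set.image_image]
  congr 1
  ext t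
  exact (hT t).symm

end ConjClasses

/-! ### Split extensions of groups of coprime orders -/

theorem isSplitExtension_iff {N Q G : Type} [Group N] [Group Q] [Group G] :
    IsSplitExtension N Q G ↔ ∃ φ : Q →* MulAut N, Nonempty (N ⋊[φ] Q ≃* G) := by
  constructor
  · rintro ⟨S, ⟨s⟩⟩
    exact ⟨s.conjAct, ⟨s.semidirectProductMulEquiv⟩⟩
  · rintro ⟨φ, ⟨e⟩⟩
    refine ⟨⟨e.toMonoidHom.comp inl, rightHom.comp e.symm.toMonoidHom, ?_, ?_, ?_⟩,
      ⟨⟨e.toMonoidHom.comp inr, ?_⟩⟩⟩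
    · exact e.injective.comp inl_injective
    · ext g
      obtain ⟨x, rfl⟩ := e.surjective g
      simp only [MonoidHom.mem_range, MonoidHom.mem_ker, MonoidHom.coe_comp, Function.comp_apply,
        MulEquiv.coe_toMonoidHom, MulEquiv.symm_apply_apply, EmbeddingLike.apply_eq_iff_eq]
      rw [← MonoidHom.mem_range, range_inl_eq_ker_rightHom, MonoidHom.mem_ker]
    · exact rightHom_surjective.comp e.symm.surjective
    · intro q
      simp

theorem eq_one_of_pow_eq_one_of_coprime {M : Type*} [Monoid M] {m n : ℕ} (h : m.Coprime n)
    {x : M} (hm : x ^ m = 1) (hn : x ^ n = 1) : x = 1 := by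
  simpa [h.gcd_eq_one] using pow_gcd_eq_one.2 ⟨hm, hn⟩

section SemidirectProduct

variable {N Q : Type*} [Group Q]

section Group

variable [Group N] {φ ψ : Q →* MulAut N} (hcop : (Nat.card N).Coprime (Nat.card Q))

include hcop

theorem inl_left_mulEquiv_inl (e : N ⋊[φ] Q ≃* N ⋊[ψ] Q) (n : N) :
    inl (e (inl n)).left = e (inl n) := by
  have hright : rightHom (e (inl n)) = 1 := by
    refine eq_one_of_pow_eq_one_of_coprime hcop ?_ pow_card_eq_one'
    rw [← map_pow, ← map_pow, ← map_pow, pow_card_eq_one', map_one, map_one, map_one]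
  obtain ⟨n', hn'⟩ : e (inl n) ∈ (inl : N →* N ⋊[ψ] Q).range := by
    rwa [range_inl_eq_ker_rightHom, MonoidHom.mem_ker]
  rw [← hn', left_inl]

theorem right_mulEquiv_apply (e : N ⋊[φ] Q ≃* N ⋊[ψ] Q) (x : N ⋊[φ] Q) :
    (e x).right = (e (inr x.right)).right := by
  conv_lhs => rw [← inl_left_mul_inr_right x, map_mul, mul_right,
    ← inl_left_mulEquiv_inl hcop, right_inl, one_mul]

/-- The automorphism of the normal factor induced by an isomorphism of semidirect products of
groups of coprime orders. -/
def normalFactorAut (e : N ⋊[φ] Q ≃* N ⋊[ψ] Q) : MulAut N where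
  toFun n := (e (inl n)).left
  invFun n := (e.symm (inl n)).left
  left_inv n := by dsimp only; rw [inl_left_mulEquiv_inl hcop, e.symm_apply_apply, left_inl]
  right_inv n := by dsimp only; rw [inl_left_mulEquiv_inl hcop, e.apply_symm_apply, left_inl]
  map_mul' x y := by
    rw [map_mul, map_mul, ← inl_left_mulEquiv_inl hcop e x, ← inl_left_mulEquiv_inl hcop e y,
      ← map_mul, left_inl, left_inl, left_inl]

/-- The automorphism of the quotient factor induced by an isomorphism of semidirect products of
groups of coprime orders. -/
def quotientFactorAut (e : N ⋊[φ] Q ≃* N ⋊[ψ] Q) : MulAut Q where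
  toFun q := (e (inr q)).right
  invFun q := (e.symm (inr q)).right
  left_inv q := by dsimp only; rw [← right_mulEquiv_apply hcop, e.symm_apply_apply, right_inr]
  right_inv q := by dsimp only; rw [← right_mulEquiv_apply hcop, e.apply_symm_apply, right_inr]
  map_mul' x y := by rw [map_mul, map_mul, mul_right]

end Group

variable [CommGroup N] {φ ψ : Q →* MulAut N}

theorem quotientFactorAut_intertwines (hcop : (Nat.card N).Coprime (Nat.card Q))
    (e : N ⋊[φ] Q ≃* N ⋊[ψ] Q) (q : Q) :
    ψ (quotientFactorAut hcop e q) * normalFactorAut hcop e =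
      normalFactorAut hcop e * φ q := by
  ext n
  have h : e (inr q) * e (inl n) = e (inl (φ q n)) * e (inr q) := by
    rw [← map_mul, ← map_mul, inl_aut, map_inv, inv_mul_cancel_right]
  rw [← inl_left_mulEquiv_inl hcop, ← inl_left_mulEquiv_inl hcop e (φ q n)] at h
  have hleft := congrArg SemidirectProduct.left h
  simp only [mul_left, left_inl, right_inl, map_one, MulAut.one_apply] at hleft
  rw [mul_comm] at hleft
  exact mul_right_cancel hleft

theorem nonempty_semidirectProduct_mulEquiv_iff (hcop : (Nat.card N).Coprime (Nat.card Q)) :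
    Nonempty (N ⋊[φ] Q ≃* N ⋊[ψ] Q) ↔
      ∃ (a : MulAut N) (b : MulAut Q), ∀ q, ψ (b q) = a * φ q * a⁻¹ := by
  constructor
  · rintro ⟨e⟩
    exact ⟨normalFactorAut hcop e, quotientFactorAut hcop e,
      fun q => eq_mul_inv_of_mul_eq (quotientFactorAut_intertwines hcop e q)⟩
  · rintro ⟨a, b, h⟩
    refine ⟨SemidirectProduct.congr a b fun q => ?_⟩
    ext n
    simpa using (DFunLike.congr_fun (h q) (a n)).symm

end SemidirectProduct

/-- Homomorphisms from `Q` to `A` are determined by their images, up to automorphisms of `Q`. -/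
def RangeDeterminesHom (Q A : Type*) [Group Q] [Group A] : Prop :=
  ∀ f g : Q →* A, f.range = g.range → ∃ b : MulAut Q, ∀ x, g (b x) = f x

/-- The subgroups of `A` that are homomorphic images of `Q`. -/
def homImages (Q A : Type*) [Group Q] [Group A] : Set (Subgroup A) :=
  Set.range fun φ : Q →* A => φ.range

theorem range_comp_of_surjective {G H K : Type*} [Group G] [Group H] [Group K] (f : H →* K)
    {g : G →* H} (hg : Function.Surjective g) : (f.comp g).range = f.range := by
  rw [MonoidHom.range_comp, MonoidHom.range_eq_top.2 hg, MonoidHom.range_eq_map]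

theorem mem_homImages_iff_exists_surjective {Q A : Type*} [Group Q] [Group A] {K : Subgroup A} :
    K ∈ homImages Q A ↔ ∃ f : Q →* K, Function.Surjective f := by
  constructor
  · rintro ⟨φ, rfl⟩
    exact ⟨φ.rangeRestrict, φ.rangeRestrict_surjective⟩
  · rintro ⟨f, hf⟩
    exact ⟨K.subtype.comp f, by
      simp only [range_comp_of_surjective K.subtype hf, Subgroup.range_subtype]⟩

theorem RangeDeterminesHom.conj_range_iff {Q A : Type*} [Group Q] [Group A]
    (hQ : RangeDeterminesHom Q A) (φ ψ : Q →* A) :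
    (∃ g : A, ψ.range = φ.range.map (MulAut.conj g).toMonoidHom) ↔
      ∃ (g : A) (b : MulAut Q), ∀ q, ψ (b q) = g * φ q * g⁻¹ := by
  refine exists_congr fun g => ?_
  rw [← MonoidHom.range_comp]
  constructor
  · exact fun h => hQ _ _ h.symm
  · rintro ⟨b, hb⟩
    rw [← range_comp_of_surjective ψ (g := b.toMonoidHom) b.surjective]
    exact congrArg MonoidHom.range (MonoidHom.ext (f := ψ.comp b.toMonoidHom) hb)

theorem nonempty_mulEquiv_iff_range_conj {N Q A : Type*} [CommGroup N] [Group Q] [Group A]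
    (hcop : (Nat.card N).Coprime (Nat.card Q)) (e : A ≃* MulAut N) (hQ : RangeDeterminesHom Q A)
    (φ ψ : Q →* A) :
    Nonempty (N ⋊[e.toMonoidHom.comp φ] Q ≃* N ⋊[e.toMonoidHom.comp ψ] Q) ↔
      ∃ g : A, ψ.range = φ.range.map (MulAut.conj g).toMonoidHom := by
  rw [nonempty_semidirectProduct_mulEquiv_iff hcop, hQ.conj_range_iff, e.surjective.exists]
  refine exists₂_congr fun a b => forall_congr' fun q => ?_
  simp [← map_inv, ← map_mul]

theorem numSplitExtensions_eq_numConjClasses {N Q A : Type} [CommGroup N] [Group Q] [Group A]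
    (hcop : (Nat.card N).Coprime (Nat.card Q)) (e : A ≃* MulAut N)
    (hQ : RangeDeterminesHom Q A) :
    numSplitExtensions N Q = numConjClasses (homImages Q A) := by
  let F (φ : Q →* A) : Quotient (splitExtensionSetoid N Q) :=
    Quotient.mk _ ⟨GrpCat.of (N ⋊[e.toMonoidHom.comp φ] Q),
      isSplitExtension_iff.2 ⟨_, ⟨MulEquiv.refl _⟩⟩⟩
  let R (φ : Q →* A) : Quotient (subgroupConjSetoid A) := Quotient.mk _ φ.range
  have hF : Function.Surjective F := by
    rintro ⟨⟨E, hE⟩⟩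
    obtain ⟨φ, ⟨f⟩⟩ := isSplitExtension_iff.1 hE
    obtain ⟨φ, rfl⟩ : ∃ φ' : Q →* A, e.toMonoidHom.comp φ' = φ :=
      ⟨e.symm.toMonoidHom.comp φ, by ext; simp⟩
    exact ⟨φ, Quotient.sound ⟨f⟩⟩
  have hFR : (Set.range F).ncard = (Set.range R).ncard :=
    ncard_range_eq_ncard_range fun φ ψ => Quotient.eq.trans <|
      (nonempty_mulEquiv_iff_range_conj hcop e hQ φ ψ).trans
        (Quotient.eq (r := subgroupConjSetoid A)).symm
  rw [hF.range_eq, Set.ncard_univ] at hFR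
  rw [numSplitExtensions, hFR, numConjClasses, homImages, ← Set.range_comp]
  rfl

/-! ### Direct decompositions of finite abelian groups -/

theorem isCompl_ker_powMonoidHom {K : Type*} [CommGroup K] {c d : ℕ} (hcd : c.Coprime d)
    (hK : ∀ x : K, x ^ (c * d) = 1) :
    IsCompl (powMonoidHom c : K →* K).ker (powMonoidHom d : K →* K).ker := by
  refine ⟨Subgroup.disjoint_def.2 fun hx hy => eq_one_of_pow_eq_one_of_coprime hcd hx hy,
    codisjoint_iff.2 (eq_top_iff.2 fun x _ => ?_)⟩
  have hbezout := Nat.gcd_eq_gcd_ab c d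
  rw [hcd.gcd_eq_one, Nat.cast_one] at hbezout
  have hx (i : ℤ) : x ^ ((c : ℤ) * d * i) = 1 := by
    rw [zpow_mul, ← Nat.cast_mul, zpow_natCast, hK, one_zpow]
  refine Subgroup.mem_sup.2
    ⟨x ^ ((d : ℤ) * c.gcdB d), ?_, x ^ ((c : ℤ) * c.gcdA d), ?_, ?_⟩
  · rw [MonoidHom.mem_ker, powMonoidHom_apply, ← zpow_natCast, ← zpow_mul,
      ← hx (c.gcdB d)]
    ring_nf
  · rw [MonoidHom.mem_ker, powMonoidHom_apply, ← zpow_natCast, ← zpow_mul,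
      ← hx (c.gcdA d)]
    ring_nf
  · rw [← zpow_add, add_comm, ← hbezout, zpow_one]

theorem isComplement'_of_isCompl {K : Type*} [CommGroup K] {H P : Subgroup K}
    (h : IsCompl H P) : H.IsComplement' P :=
  Subgroup.isComplement'_of_disjoint_and_mul_eq_univ h.disjoint <| by
    rw [← Subgroup.mul_normal, h.sup_eq_top, Subgroup.coe_top]

/-- A commutative group is the direct product of two complementary subgroups. -/
noncomputable def prodEquivOfIsCompl {K : Type*} [CommGroup K] {H P : Subgroup K}
    (h : IsCompl H P) : H × P ≃* K :=
  MulEquiv.ofBijective (H.subtype.coprod P.subtype) (isComplement'_of_isCompl h)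

@[simp] theorem prodEquivOfIsCompl_apply {K : Type*} [CommGroup K] {H P : Subgroup K}
    (h : IsCompl H P) (x : H × P) : prodEquivOfIsCompl h x = x.1 * x.2 := rfl

/-- A complement of the kernel of `f` is mapped isomorphically onto the range of `f`. -/
noncomputable def complKerEquivRange {K A : Type*} [CommGroup K] [Group A] {f : K →* A}
    {P : Subgroup K} (h : IsCompl f.ker P) : P ≃* f.range :=
  (isComplement'_of_isCompl h.symm).QuotientMulEquiv.symm.trans
    (QuotientGroup.quotientKerEquivRange f)

theorem coe_complKerEquivRange {K A : Type*} [CommGroup K] [Group A] {f : K →* A}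
    {P : Subgroup K} (h : IsCompl f.ker P) (x : P) : (complKerEquivRange h x : A) = f x := rfl

theorem isSemisimpleModule_zmod_of_squarefree {d : ℕ} (hd : Squarefree d) (M : Type*)
    [AddCommGroup M] [Module (ZMod d) M] : IsSemisimpleModule (ZMod d) M := by
  have : NeZero d := ⟨hd.ne_zero⟩
  have : Fact (Squarefree d) := ⟨hd⟩
  have : IsSemisimpleRing (ZMod d) := IsArtinianRing.isSemisimpleRing_of_isReduced _
  infer_instance

theorem exists_isCompl_addSubgroup_of_squarefree {d : ℕ} (hd : Squarefree d) {M : Type*}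
    [AddCommGroup M] (hM : ∀ x : M, d • x = 0) (H : AddSubgroup M) :
    ∃ P : AddSubgroup M, IsCompl H P := by
  let _ : Module (ZMod d) M := AddCommGroup.zmodModule hM
  obtain ⟨P, hP⟩ := (isSemisimpleModule_zmod_of_squarefree hd M).toComplementedLattice
    |>.exists_isCompl (AddSubgroup.toZModSubmodule d H)
  exact ⟨_, (AddSubgroup.toZModSubmodule d).isCompl_iff.2 (by rwa [OrderIso.apply_symm_apply])⟩

theorem exists_isCompl_of_squarefree {E : Type*} [CommGroup E] {d : ℕ} (hd : Squarefree d)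
    (hE : ∀ x : E, x ^ d = 1) (H : Subgroup E) : ∃ P : Subgroup E, IsCompl H P := by
  let i : Subgroup E ≃o AddSubgroup (Additive E) := Subgroup.toAddSubgroup
  obtain ⟨P, hP⟩ := exists_isCompl_addSubgroup_of_squarefree hd (fun x => hE x.toMul) (i H)
  exact ⟨i.symm P, i.isCompl_iff.2 (by rwa [i.apply_symm_apply])⟩

theorem dvd_of_mul_dvd_mul_self_of_squarefree {d m k : ℕ} (hd : Squarefree d) (hmd : m ∣ d)
    (hprime : ∀ r : ℕ, r.Prime → r ∣ k → r ∣ m) (h : m * k ∣ d * d) : k ∣ m := by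
  obtain ⟨n, rfl⟩ := hmd
  have hkn : k.Coprime n := Nat.Coprime.symm <| Nat.coprime_of_dvd fun r hr hrn hrk =>
    hr.one_lt.ne' (Nat.isUnit_iff.1 (hd r (mul_dvd_mul (hprime r hr hrk) hrn)))
  have hm : 0 < m := Nat.pos_of_ne_zero (left_ne_zero_of_mul hd.ne_zero)
  rw [mul_assoc m n, mul_dvd_mul_iff_left hm.ne', mul_comm m n, ← mul_assoc] at h
  exact (hkn.mul_right hkn).dvd_of_dvd_mul_left h

theorem exists_mulEquiv_cyc_prod_cyc {E : Type*} [CommGroup E] [Finite E] {d : ℕ}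
    (hd : Squarefree d) (hE : ∀ x : E, x ^ d = 1) (hcard : Nat.card E ∣ d * d) :
    ∃ b e : ℕ, b ∣ d ∧ e ∣ b ∧ Nonempty (E ≃* Cyc b × Cyc e) := by
  obtain ⟨x, hx⟩ := Monoid.exists_orderOf_eq_exponent (Monoid.ExponentExists.of_finite (G := E))
  obtain ⟨P, hP⟩ := exists_isCompl_of_squarefree hd hE (Subgroup.zpowers x)
  have hxd : orderOf x ∣ d := orderOf_dvd_of_pow_eq_one (hE x)
  have hcard_mul : Nat.card E = orderOf x * Nat.card P := by
    rw [← Nat.card_congr (prodEquivOfIsCompl hP).toEquiv, Nat.card_prod, Nat.card_zpowers]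
  have hPx : Nat.card P ∣ orderOf x := by
    refine dvd_of_mul_dvd_mul_self_of_squarefree hd hxd (fun r hr hrP => ?_) (hcard_mul ▸ hcard)
    have := Fact.mk hr
    obtain ⟨y, hy⟩ := exists_prime_orderOf_dvd_card' (G := P) r hrP
    rw [hx, ← hy, ← Subgroup.orderOf_coe]
    exact Monoid.order_dvd_exponent _
  have : IsZGroup P := IsZGroup.of_squarefree (hd.squarefree_of_dvd (hPx.trans hxd))
  have hxcyc := zmodCyclicMulEquiv (inferInstance : IsCyclic (Subgroup.zpowers x))
  rw [Nat.card_zpowers] at hxcyc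
  exact ⟨orderOf x, Nat.card P, hxd, hPx, ⟨(prodEquivOfIsCompl hP).symm.trans
    (hxcyc.symm.prodCongr (zmodCyclicMulEquiv inferInstance).symm)⟩⟩

/-! ### Homomorphisms with the same image -/

theorem exists_coprime_modEq {m n u : ℕ} [NeZero n] (h : m ∣ n) (hu : u.Coprime m) :
    ∃ v : ℕ, v.Coprime n ∧ v ≡ u [MOD m] := by
  obtain ⟨v, hv⟩ := ZMod.unitsMap_surjective h (ZMod.unitOfCoprime u hu)
  refine ⟨(v : ZMod n).val, ZMod.val_coe_unit_coprime v, ?_⟩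
  rw [← ZMod.natCast_eq_natCast_iff, ← ZMod.coe_unitOfCoprime u hu, ← hv, ZMod.unitsMap_val,
    ZMod.natCast_val]

theorem exists_generator_apply_eq {C A : Type*} [Group C] [Finite C] [IsCyclic C] [Group A]
    (f : C →* A) {y : A} (hy : Subgroup.zpowers y = f.range) :
    ∃ w : C, (∀ x, x ∈ Subgroup.zpowers w) ∧ f w = y := by
  obtain ⟨z, hz⟩ := IsCyclic.exists_generator (α := C)
  have hfz : f z ∈ Subgroup.zpowers y := hy ▸ ⟨z, rfl⟩
  obtain ⟨x, hx⟩ : y ∈ f.range := hy ▸ Subgroup.mem_zpowers y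
  obtain ⟨u, rfl⟩ := mem_powers_iff_mem_zpowers.2 (hz x)
  rw [← hx, map_pow, mem_zpowers_pow_iff] at hfz
  have : NeZero (orderOf z) := ⟨(orderOf_pos z).ne'⟩
  obtain ⟨v, hvz, hvu⟩ := exists_coprime_modEq (orderOf_map_dvd f z) hfz
  refine ⟨z ^ v, fun x => ?_, ?_⟩
  · exact Subgroup.zpowers_le.2 (mem_zpowers_pow_iff.2 hvz) (hz x)
  · rw [← hx, map_pow, map_pow, pow_eq_pow_iff_modEq.2 hvu]

theorem rangeDeterminesHom_of_isCyclic (C A : Type*) [Group C] [Finite C] [IsCyclic C]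
    [Group A] : RangeDeterminesHom C A := by
  intro f g h
  obtain ⟨z, hz⟩ := IsCyclic.exists_generator (α := C)
  have hfz : Subgroup.zpowers (f z) = g.range := by
    rw [← h, ← MonoidHom.map_zpowers, (Subgroup.eq_top_iff' _).2 hz, MonoidHom.range_eq_map]
  obtain ⟨w, hw, hgw⟩ := exists_generator_apply_eq g hfz
  have hzw : orderOf z = orderOf w := by
    rw [orderOf_eq_card_of_forall_mem_zpowers hz, orderOf_eq_card_of_forall_mem_zpowers hw]
  let b : MulAut C := mulEquivOfOrderOfEq hz hw hzw
  have hgb : g.comp b.toMonoidHom = f := by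
    rw [MonoidHom.eq_iff_eq_on_generator hz]
    exact (congrArg g (mulEquivOfOrderOfEq_apply_gen hz hw hzw)).trans hgw
  exact ⟨b, DFunLike.congr_fun hgb⟩

theorem rangeDeterminesHom_of_squarefree {E A : Type*} [CommGroup E] [Group A] {d : ℕ}
    (hd : Squarefree d) (hE : ∀ x : E, x ^ d = 1)
    (hker : ∀ f g : E →* A, f.range = g.range → Nonempty (f.ker ≃* g.ker)) :
    RangeDeterminesHom E A := by
  intro f g h
  obtain ⟨P, hP⟩ := exists_isCompl_of_squarefree hd hE f.ker
  obtain ⟨P', hP'⟩ := exists_isCompl_of_squarefree hd hE g.ker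
  obtain ⟨θ⟩ := hker f g h
  let i : P ≃* P' := (complKerEquivRange hP).trans
    ((MulEquiv.subgroupCongr h).trans (complKerEquivRange hP').symm)
  refine ⟨(prodEquivOfIsCompl hP).symm.trans
    ((θ.prodCongr i).trans (prodEquivOfIsCompl hP')), fun x => ?_⟩
  obtain ⟨⟨y, z⟩, rfl⟩ := (prodEquivOfIsCompl hP).surjective x
  have hiz : g (i z) = f z := by
    rw [← coe_complKerEquivRange hP', ← coe_complKerEquivRange hP]
    simp only [i, MulEquiv.trans_apply, MulEquiv.apply_symm_apply, MulEquiv.subgroupCongr_apply]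
  have hθy : g (θ y) = 1 := (θ y).2
  have hfy : f y = 1 := y.2
  rw [MulEquiv.trans_apply, MulEquiv.symm_apply_apply, MulEquiv.trans_apply,
    prodEquivOfIsCompl_apply, prodEquivOfIsCompl_apply, map_mul, map_mul, hfy, ← hiz]
  exact congrArg (· * g (i z)) hθy

section CoprimeProd

variable {C E A : Type*} [Group C] [Group E] [Group A] {c d : ℕ}

theorem prod_pow_mul_eq_one (hC : ∀ x : C, x ^ c = 1) (hE : ∀ y : E, y ^ d = 1) (z : C × E) :
    z ^ (c * d) = 1 := by
  ext
  · rw [Prod.pow_fst, pow_mul, hC, one_pow, Prod.fst_one]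
  · rw [Prod.pow_snd, mul_comm, pow_mul, hE, one_pow, Prod.snd_one]

theorem mem_range_comp_inl_iff (hcd : c.Coprime d) (hC : ∀ x : C, x ^ c = 1)
    (hE : ∀ y : E, y ^ d = 1) (f : C × E →* A) (x : A) :
    x ∈ (f.comp (MonoidHom.inl C E)).range ↔ x ∈ f.range ∧ x ^ c = 1 := by
  constructor
  · rintro ⟨u, rfl⟩
    exact ⟨⟨_, rfl⟩, by rw [← map_pow, hC, map_one]⟩
  · rintro ⟨⟨⟨u, v⟩, rfl⟩, h⟩
    have hfv : f (1, v) = 1 := by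
      refine eq_one_of_pow_eq_one_of_coprime hcd ?_ ?_
      · rwa [← map_pow, show (u, v) ^ c = ((1, v) ^ c : C × E) by simp [hC], map_pow] at h
      · rw [← map_pow, Prod.pow_mk, one_pow, hE, ← Prod.one_eq_mk, map_one]
    exact ⟨u, by rw [← Prod.fst_mul_snd (u, v), map_mul, hfv, mul_one]; rfl⟩

theorem mem_range_comp_inr_iff (hcd : c.Coprime d) (hC : ∀ x : C, x ^ c = 1)
    (hE : ∀ y : E, y ^ d = 1) (f : C × E →* A) (x : A) :
    x ∈ (f.comp (MonoidHom.inr C E)).range ↔ x ∈ f.range ∧ x ^ d = 1 := by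
  have h := mem_range_comp_inl_iff hcd.symm hE hC
    (f.comp (MulEquiv.prodComm : E × C ≃* C × E).toMonoidHom) x
  rwa [range_comp_of_surjective f (MulEquiv.surjective _)] at h

theorem RangeDeterminesHom.prod (hcd : c.Coprime d) (hC : ∀ x : C, x ^ c = 1)
    (hE : ∀ y : E, y ^ d = 1) (hCA : RangeDeterminesHom C A) (hEA : RangeDeterminesHom E A) :
    RangeDeterminesHom (C × E) A := by
  intro f g h
  obtain ⟨b₁, hb₁⟩ := hCA (f.comp (MonoidHom.inl C E)) (g.comp (MonoidHom.inl C E)) <| by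
    ext x
    rw [mem_range_comp_inl_iff hcd hC hE, mem_range_comp_inl_iff hcd hC hE, h]
  obtain ⟨b₂, hb₂⟩ := hEA (f.comp (MonoidHom.inr C E)) (g.comp (MonoidHom.inr C E)) <| by
    ext x
    rw [mem_range_comp_inr_iff hcd hC hE, mem_range_comp_inr_iff hcd hC hE, h]
  refine ⟨b₁.prodCongr b₂, fun ⟨u, v⟩ => ?_⟩
  change g (b₁ u, b₂ v) = _
  rw [← Prod.fst_mul_snd (u, v), ← Prod.fst_mul_snd (b₁ u, b₂ v), map_mul, map_mul]
  exact congrArg₂ (· * ·) (hb₁ u) (hb₂ v)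

theorem RangeDeterminesHom.congr {Q Q' A : Type*} [Group Q] [Group Q'] [Group A] (i : Q ≃* Q')
    (h : RangeDeterminesHom Q' A) : RangeDeterminesHom Q A := by
  intro f g hfg
  obtain ⟨b, hb⟩ := h (f.comp i.symm.toMonoidHom) (g.comp i.symm.toMonoidHom) <| by
    rwa [range_comp_of_surjective _ (MulEquiv.surjective _),
      range_comp_of_surjective _ (MulEquiv.surjective _)]
  exact ⟨(i.trans b).trans i.symm, fun x => by simpa using hb (i x)⟩

end CoprimeProd

/-! ### Subgroups and images of `Cyc (c * d) × Cyc d` -/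

theorem card_cyc (n : ℕ) : Nat.card (Cyc n) = n := Nat.card_zmod n

theorem cyc_pow_eq_one (n : ℕ) (x : Cyc n) : x ^ n = 1 := by
  simpa only [card_cyc] using pow_card_eq_one' (x := x)

theorem cyc_prod_cyc_pow_eq_one (n : ℕ) (x : Cyc n × Cyc n) : x ^ n = 1 :=
  Prod.ext (cyc_pow_eq_one n _) (cyc_pow_eq_one n _)

theorem exists_cyc_surjective {m n : ℕ} (h : m ∣ n) :
    ∃ f : Cyc n →* Cyc m, Function.Surjective f :=
  ⟨AddMonoidHom.toMultiplicative (ZMod.castHom h (ZMod m)).toAddMonoidHom,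
    ZMod.castHom_surjective h⟩

/-- The Chinese remainder decomposition of `Cyc (c * d) × Cyc d`. -/
def cycProdEquiv {c d : ℕ} (hcd : c.Coprime d) :
    Cyc (c * d) × Cyc d ≃* Cyc c × (Cyc d × Cyc d) :=
  ((((ZMod.chineseRemainder hcd).toAddEquiv.toMultiplicative).trans
    (MulEquiv.prodMultiplicative _ _)).prodCongr (MulEquiv.refl _)).trans MulEquiv.prodAssoc

/-- The structure common to the subgroups and to the homomorphic images of
`Cyc (c * d) × Cyc d`: a product of cyclic groups of orders `a ∣ c`, `b ∣ d` and `e ∣ b`. -/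
def HasCycDecomposition (c d : ℕ) (K : Type*) [Group K] : Prop :=
  ∃ a b e : ℕ, a ∣ c ∧ b ∣ d ∧ e ∣ b ∧ Nonempty (K ≃* Cyc a × (Cyc b × Cyc e))

theorem HasCycDecomposition.congr {c d : ℕ} {K L : Type*} [Group K] [Group L]
    (h : HasCycDecomposition c d K) (i : K ≃* L) : HasCycDecomposition c d L := by
  obtain ⟨a, b, e, ha, hb, he, ⟨j⟩⟩ := h
  exact ⟨a, b, e, ha, hb, he, ⟨i.symm.trans j⟩⟩

theorem hasCycDecomposition_of_ker_pow {K : Type*} [CommGroup K] [Finite K] {c d : ℕ}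
    (hcd : c.Coprime d) (hd : Squarefree d) (hK : ∀ x : K, x ^ (c * d) = 1)
    (hcyc : IsCyclic (powMonoidHom c : K →* K).ker)
    (hcard : Nat.card (powMonoidHom d : K →* K).ker ∣ d * d) : HasCycDecomposition c d K := by
  obtain ⟨b, e, hb, he, ⟨i⟩⟩ := exists_mulEquiv_cyc_prod_cyc hd
    (fun x : (powMonoidHom d : K →* K).ker => Subtype.ext x.2) hcard
  refine ⟨_, b, e, ?_, hb, he, ⟨(prodEquivOfIsCompl (isCompl_ker_powMonoidHom hcd hK)).symm.trans
    ((zmodCyclicMulEquiv hcyc).symm.prodCongr i)⟩⟩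
  rw [← hcyc.exponent_eq_card]
  exact Monoid.exponent_dvd_of_forall_pow_eq_one fun x => Subtype.ext x.2

section CoprimeProd

variable {C E K : Type*} [CommGroup C] [CommGroup E] [CommGroup K] [Finite C] [IsCyclic C]
  [Finite E] {c d : ℕ}

theorem hasCycDecomposition_of_injective (hcd : c.Coprime d) (hd : Squarefree d)
    (hC : ∀ x : C, x ^ c = 1) (hE : ∀ y : E, y ^ d = 1) (hcard : Nat.card E ∣ d * d)
    (ι : K →* C × E) (hι : Function.Injective ι) : HasCycDecomposition c d K := by
  have : Finite K := Finite.of_injective ι hι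
  refine hasCycDecomposition_of_ker_pow hcd hd
    (fun x => hι (by rw [map_pow, prod_pow_mul_eq_one hC hE, map_one])) ?_ ?_
  · refine isCyclic_of_injective ((MonoidHom.fst C E).comp (ι.comp (Subgroup.subtype _)))
      ((injective_iff_map_eq_one _).2 fun ⟨x, (hx : x ^ c = 1)⟩ hfst => Subtype.ext (hι ?_))
    have hsnd : (ι x).2 ^ c = 1 := by rw [← Prod.pow_snd, ← map_pow, hx, map_one, Prod.snd_one]
    rw [OneMemClass.coe_one, map_one]
    exact Prod.ext hfst (eq_one_of_pow_eq_one_of_coprime hcd hsnd (hE _))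
  · refine (Subgroup.card_dvd_of_injective ((MonoidHom.snd C E).comp (ι.comp (Subgroup.subtype _)))
      ((injective_iff_map_eq_one _).2 fun ⟨x, hx⟩ hsnd => Subtype.ext (hι ?_))).trans hcard
    change x ^ d = 1 at hx
    have hfst : (ι x).1 ^ d = 1 := by rw [← Prod.pow_fst, ← map_pow, hx, map_one, Prod.fst_one]
    rw [OneMemClass.coe_one, map_one]
    exact Prod.ext (eq_one_of_pow_eq_one_of_coprime hcd (hC _) hfst) hsnd

theorem hasCycDecomposition_of_surjective (hcd : c.Coprime d) (hd : Squarefree d)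
    (hC : ∀ x : C, x ^ c = 1) (hE : ∀ y : E, y ^ d = 1) (hcard : Nat.card E ∣ d * d)
    (π : C × E →* K) (hπ : Function.Surjective π) : HasCycDecomposition c d K := by
  have : Finite K := Finite.of_surjective π hπ
  have hc : (powMonoidHom c : K →* K).ker = (π.comp (MonoidHom.inl C E)).range := by
    ext x
    rw [mem_range_comp_inl_iff hcd hC hE, MonoidHom.mem_ker, powMonoidHom_apply]
    exact (and_iff_right (hπ x)).symm
  have hd' : (powMonoidHom d : K →* K).ker = (π.comp (MonoidHom.inr C E)).range := by
    ext x
    rw [mem_range_comp_inr_iff hcd hC hE, MonoidHom.mem_ker, powMonoidHom_apply]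
    exact (and_iff_right (hπ x)).symm
  refine hasCycDecomposition_of_ker_pow hcd hd (fun x => ?_) ?_ ?_
  · obtain ⟨z, rfl⟩ := hπ x
    rw [← map_pow, prod_pow_mul_eq_one hC hE, map_one]
  · rw [hc]
    exact isCyclic_of_surjective _ (MonoidHom.rangeRestrict_surjective _)
  · rw [hd']
    exact (Subgroup.card_range_dvd _).trans hcard

theorem hasCycDecomposition_range {A : Type*} [Group A] (hcd : c.Coprime d) (hd : Squarefree d)
    (hC : ∀ x : C, x ^ c = 1) (hE : ∀ y : E, y ^ d = 1) (hcard : Nat.card E ∣ d * d)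
    (f : C × E →* A) : HasCycDecomposition c d f.range :=
  (hasCycDecomposition_of_surjective hcd hd hC hE hcard (QuotientGroup.mk' f.ker)
    (QuotientGroup.mk'_surjective _)).congr (QuotientGroup.quotientKerEquivRange f)

end CoprimeProd

theorem eq_gcd_of_dvd_of_squarefree {c d a b e : ℕ} (hcd : c.Coprime d) (hd : Squarefree d)
    (ha : a ∣ c) (hb : b ∣ d) (he : e ∣ b) :
    a = (a * (b * e)).gcd c ∧ b = (a * (b * e)).gcd d := by
  have had : a.Coprime d := hcd.coprime_dvd_left ha
  have hbc : b.Coprime c := hcd.symm.coprime_dvd_left hb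
  constructor
  · rw [Nat.gcd_comm, Nat.Coprime.gcd_mul_right_cancel_right _
      (hbc.mul_left (hbc.coprime_dvd_left he)), Nat.gcd_eq_right ha]
  · rw [Nat.gcd_comm, Nat.Coprime.gcd_mul_left_cancel_right _ had]
    refine Nat.dvd_antisymm (Nat.dvd_gcd hb (dvd_mul_right _ _)) ?_
    have hsq : Squarefree (d.gcd (b * e)) := hd.squarefree_of_dvd (Nat.gcd_dvd_left _ _)
    rw [← hsq.dvd_pow_iff_dvd two_ne_zero, sq]
    exact (Nat.gcd_dvd_right _ _).trans (mul_dvd_mul_left _ he)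

theorem HasCycDecomposition.nonempty_mulEquiv {c d : ℕ} (hc : c ≠ 0) (hcd : c.Coprime d)
    (hd : Squarefree d) {K L : Type*} [Group K] [Group L] (hK : HasCycDecomposition c d K)
    (hL : HasCycDecomposition c d L) (h : Nat.card K = Nat.card L) : Nonempty (K ≃* L) := by
  obtain ⟨a, b, e, ha, hb, he, ⟨i⟩⟩ := hK
  obtain ⟨a', b', e', ha', hb', he', ⟨j⟩⟩ := hL
  simp only [Nat.card_congr i.toEquiv, Nat.card_congr j.toEquiv, Nat.card_prod, card_cyc] at h
  obtain ⟨hac, hbd⟩ := eq_gcd_of_dvd_of_squarefree hcd hd ha hb he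
  obtain ⟨hac', hbd'⟩ := eq_gcd_of_dvd_of_squarefree hcd hd ha' hb' he'
  obtain rfl : a = a' := by rw [hac, hac', h]
  obtain rfl : b = b' := by rw [hbd, hbd', h]
  obtain rfl : e = e' := mul_left_cancel₀ (ne_zero_of_dvd_ne_zero hd.ne_zero hb)
    (mul_left_cancel₀ (ne_zero_of_dvd_ne_zero hc ha) h)
  exact ⟨i.trans j.symm⟩

theorem HasCycDecomposition.exists_surjective {c d : ℕ} {K : Type*} [Group K]
    (hK : HasCycDecomposition c d K) :
    ∃ f : Cyc c × (Cyc d × Cyc d) →* K, Function.Surjective f := by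
  obtain ⟨a, b, e, ha, hb, he, ⟨i⟩⟩ := hK
  obtain ⟨f, hf⟩ := exists_cyc_surjective ha
  obtain ⟨g, hg⟩ := exists_cyc_surjective hb
  obtain ⟨h, hh⟩ := exists_cyc_surjective (he.trans hb)
  exact ⟨i.symm.toMonoidHom.comp (f.prodMap (g.prodMap h)),
    i.symm.surjective.comp (hf.prodMap (hg.prodMap hh))⟩

theorem dvd_of_injective_cyc {M : Type*} [Monoid M] {k n : ℕ} (hM : ∀ x : M, x ^ n = 1)
    (f : Cyc k →* M) (hf : Function.Injective f) : k ∣ n := by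
  rw [← card_cyc k, ← IsCyclic.exponent_eq_card]
  exact Monoid.exponent_dvd_of_forall_pow_eq_one fun x => hf (by rw [map_pow, hM, map_one])

theorem HasCycDecomposition.card_dvd {c d n : ℕ} {K : Type*} [Group K] (hcd : c.Coprime d)
    (hK : HasCycDecomposition c d K) (hn : ∀ x : K, x ^ n = 1) :
    Nat.card K ∣ (c * d).gcd n * d.gcd n := by
  obtain ⟨a, b, e, ha, hb, he, ⟨i⟩⟩ := hK
  have han : a ∣ n := dvd_of_injective_cyc hn (i.symm.toMonoidHom.comp (MonoidHom.inl _ _))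
    (i.symm.injective.comp (Prod.mk_left_injective _))
  have hbn : b ∣ n := dvd_of_injective_cyc hn
    (i.symm.toMonoidHom.comp ((MonoidHom.inr _ _).comp (MonoidHom.inl _ _)))
    (i.symm.injective.comp ((Prod.mk_right_injective _).comp (Prod.mk_left_injective _)))
  have hab : a.Coprime b := (hcd.coprime_dvd_left ha).coprime_dvd_right hb
  rw [Nat.card_congr i.toEquiv, Nat.card_prod, Nat.card_prod, card_cyc, card_cyc, card_cyc,
    ← mul_assoc]
  exact mul_dvd_mul (Nat.dvd_gcd (mul_dvd_mul ha hb) (hab.mul_dvd_of_dvd_of_dvd han hbn))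
    (Nat.dvd_gcd (he.trans hb) (he.trans hbn))

theorem card_cyc_prod_cyc_dvd (n : ℕ) : Nat.card (Cyc n × Cyc n) ∣ n * n := by
  rw [Nat.card_prod, card_cyc]

theorem exists_orderOf_eq_of_isCyclic {G : Type*} [Group G] [Finite G] [IsCyclic G] {t : ℕ}
    (h : t ∣ Nat.card G) : ∃ x : G, orderOf x = t := by
  obtain ⟨z, hz⟩ := IsCyclic.exists_ofOrder_eq_natCard (α := G)
  exact ⟨z ^ (orderOf z / t), orderOf_pow_orderOf_div (orderOf_pos z).ne' (hz ▸ h)⟩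

theorem exists_subgroup_card_eq_of_isCyclic {G : Type*} [Group G] [Finite G] [IsCyclic G] {t : ℕ}
    (h : t ∣ Nat.card G) : ∃ H : Subgroup G, Nat.card H = t := by
  obtain ⟨x, rfl⟩ := exists_orderOf_eq_of_isCyclic h
  exact ⟨Subgroup.zpowers x, Nat.card_zpowers x⟩

theorem exists_subgroup_prod_card_eq {G H : Type*} [Group G] [Group H] [Finite G] [Finite H]
    [IsCyclic G] [IsCyclic H] {t : ℕ} (h : t ∣ Nat.card G * Nat.card H) :
    ∃ K : Subgroup (G × H), Nat.card K = t := by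
  obtain ⟨u, v, hu, hv, rfl⟩ := Nat.dvd_mul.1 h
  obtain ⟨K, rfl⟩ := exists_subgroup_card_eq_of_isCyclic hu
  obtain ⟨L, rfl⟩ := exists_subgroup_card_eq_of_isCyclic hv
  exact ⟨K.prod L, by rw [Nat.card_congr (K.prodEquiv L).toEquiv, Nat.card_prod]⟩

theorem card_ker_eq_of_range_eq {G A : Type*} [Group G] [Finite G] [Group A] {f g : G →* A}
    (h : f.range = g.range) : Nat.card f.ker = Nat.card g.ker := by
  have hf := f.ker.card_mul_index
  rw [← g.ker.card_mul_index, Subgroup.index_ker, Subgroup.index_ker, h] at hf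
  have : Finite g.range := Set.finite_range g
  exact Nat.eq_of_mul_eq_mul_right Nat.card_pos hf

section CycProd

variable {c d : ℕ} [NeZero c]

theorem hasCycDecomposition_subgroup (hcd : c.Coprime d) (hd : Squarefree d)
    (H : Subgroup (Cyc (c * d) × Cyc d)) : HasCycDecomposition c d H := by
  have : NeZero d := ⟨hd.ne_zero⟩
  exact hasCycDecomposition_of_injective hcd hd (cyc_pow_eq_one c) (cyc_prod_cyc_pow_eq_one d)
    (card_cyc_prod_cyc_dvd d) ((cycProdEquiv hcd).toMonoidHom.comp H.subtype)
    ((cycProdEquiv hcd).injective.comp H.subtype_injective)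

theorem nonempty_subgroup_mulEquiv_of_card_eq (hcd : c.Coprime d) (hd : Squarefree d)
    {H₁ H₂ : Subgroup (Cyc (c * d) × Cyc d)} (h : Nat.card H₁ = Nat.card H₂) :
    Nonempty (H₁ ≃* H₂) :=
  (hasCycDecomposition_subgroup hcd hd H₁).nonempty_mulEquiv (NeZero.ne c) hcd hd
    (hasCycDecomposition_subgroup hcd hd H₂) h

theorem mem_homImages_iff_hasCycDecomposition (hcd : c.Coprime d) (hd : Squarefree d)
    {A : Type*} [Group A] (K : Subgroup A) :
    K ∈ homImages (Cyc (c * d) × Cyc d) A ↔ HasCycDecomposition c d K := by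
  have : NeZero d := ⟨hd.ne_zero⟩
  constructor
  · rintro ⟨φ, rfl⟩
    have h := hasCycDecomposition_range hcd hd (cyc_pow_eq_one c) (cyc_prod_cyc_pow_eq_one d)
      (card_cyc_prod_cyc_dvd d) (φ.comp (cycProdEquiv hcd).symm.toMonoidHom)
    rwa [range_comp_of_surjective _ (MulEquiv.surjective _)] at h
  · intro h
    obtain ⟨f, hf⟩ := h.exists_surjective
    exact mem_homImages_iff_exists_surjective.2
      ⟨f.comp (cycProdEquiv hcd).toMonoidHom, hf.comp (cycProdEquiv hcd).surjective⟩

theorem rangeDeterminesHom_cyc_prod_cyc_self (hd : Squarefree d) (A : Type*) [Group A] :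
    RangeDeterminesHom (Cyc d × Cyc d) A := by
  have : NeZero d := ⟨hd.ne_zero⟩
  refine rangeDeterminesHom_of_squarefree hd (cyc_prod_cyc_pow_eq_one d) fun f g h => ?_
  have hker (K : Subgroup (Cyc d × Cyc d)) : HasCycDecomposition 1 d K :=
    hasCycDecomposition_of_injective (Nat.coprime_one_left d) hd (cyc_pow_eq_one 1)
      (cyc_prod_cyc_pow_eq_one d) (card_cyc_prod_cyc_dvd d) ((MonoidHom.inr _ _).comp K.subtype)
      ((Prod.mk_right_injective _).comp K.subtype_injective)
  exact (hker _).nonempty_mulEquiv one_ne_zero (Nat.coprime_one_left d) hd (hker _)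
    (card_ker_eq_of_range_eq h)

theorem rangeDeterminesHom_cyc_prod_cyc (hcd : c.Coprime d) (hd : Squarefree d) (A : Type*)
    [Group A] : RangeDeterminesHom (Cyc (c * d) × Cyc d) A :=
  .congr (cycProdEquiv hcd) <| .prod hcd (cyc_pow_eq_one c) (cyc_prod_cyc_pow_eq_one d)
    (rangeDeterminesHom_of_isCyclic _ A) (rangeDeterminesHom_cyc_prod_cyc_self hd A)

end CycProd

theorem mem_homImages_cyc_prod_cyc_iff_of_isCyclic {A : Type*} [Group A] {k d : ℕ} (hdk : d ∣ k)
    (K : Subgroup A) [IsCyclic K] : K ∈ homImages (Cyc k × Cyc d) A ↔ Nat.card K ∣ k := by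
  rw [mem_homImages_iff_exists_surjective]
  constructor
  · rintro ⟨f, hf⟩
    rw [← IsCyclic.exponent_eq_card]
    refine Monoid.exponent_dvd_of_forall_pow_eq_one fun x => ?_
    obtain ⟨z, rfl⟩ := hf x
    have hzk : z ^ k = 1 := Prod.ext (cyc_pow_eq_one _ _) (orderOf_dvd_iff_pow_eq_one.1
      ((orderOf_dvd_of_pow_eq_one (cyc_pow_eq_one d z.2)).trans hdk))
    rw [← map_pow, hzk, map_one]
  · intro h
    obtain ⟨f, hf⟩ := exists_cyc_surjective h
    let i := zmodCyclicMulEquiv (inferInstance : IsCyclic K)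
    exact ⟨(i.toMonoidHom.comp f).comp (MonoidHom.fst _ _),
      (i.surjective.comp hf).comp Prod.fst_surjective⟩

theorem coprime_card_of_mem_homImages {Q A : Type*} [Group Q] [Group A] {p : ℕ}
    (hQ : (Nat.card Q).Coprime p) {K : Subgroup A} (hK : K ∈ homImages Q A) :
    (Nat.card K).Coprime p := by
  obtain ⟨φ, rfl⟩ := hK
  exact hQ.coprime_dvd_left (Subgroup.card_range_dvd φ)

/-! ### Matrices over finite fields -/

section Charpoly

open Polynomial

variable {n F : Type*} [Fintype n] [DecidableEq n] [Field F]

theorem isRoot_charpoly_iff {M : Matrix n n F} {χ : F} :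
    M.charpoly.IsRoot χ ↔ ∃ v ≠ 0, M.mulVec v = χ • v := by
  rw [Polynomial.IsRoot, Matrix.eval_charpoly, ← Matrix.exists_mulVec_eq_zero_iff]
  simp only [Matrix.sub_mulVec, Matrix.scalar_apply, Matrix.diagonal_const_mulVec, sub_eq_zero,
    eq_comm]

theorem irreducible_charpoly_fin_two_iff {M : Matrix (Fin 2) (Fin 2) F} :
    Irreducible M.charpoly ↔ ∀ χ, ¬ M.charpoly.IsRoot χ := by
  refine ⟨fun h χ hχ => ?_, irreducible_of_degree_le_three_of_not_isRoot
    (by simp [Matrix.charpoly_natDegree_eq_dim])⟩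
  have h1 := degree_eq_one_of_irreducible_of_root h hχ
  rw [Matrix.charpoly_degree_eq_dim] at h1
  simp at h1

theorem exists_mul_eq_mul_companion {M : Matrix (Fin 2) (Fin 2) F} (hM : M 1 0 ≠ 0) :
    ∃ x : GL (Fin 2) F, M * x = x * !![0, -M.det; 1, M.trace] := by
  -- The columns of `x` are `e₁` and `M e₁`.
  refine ⟨Matrix.GeneralLinearGroup.mkOfDetNeZero !![1, M 0 0; 0, M 1 0]
    (by simpa [Matrix.det_fin_two] using hM), ?_⟩
  change M * !![1, M 0 0; 0, M 1 0] = !![1, M 0 0; 0, M 1 0] * _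
  ext i j
  fin_cases i <;> fin_cases j <;>
    simp [Matrix.mul_apply, Fin.sum_univ_two, Matrix.trace_fin_two, Matrix.det_fin_two] <;> ring

theorem apply_one_zero_ne_zero_of_irreducible_charpoly {M : Matrix (Fin 2) (Fin 2) F}
    (hM : Irreducible M.charpoly) : M 1 0 ≠ 0 := fun h0 =>
  irreducible_charpoly_fin_two_iff.1 hM (M 0 0) <| by
    rw [Polynomial.IsRoot, Matrix.eval_charpoly, Matrix.det_fin_two]
    simp [h0]

theorem isConj_of_irreducible_of_charpoly_eq {g h : GL (Fin 2) F}
    (hg : Irreducible g.val.charpoly) (hgh : g.val.charpoly = h.val.charpoly) : IsConj g h := by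
  obtain ⟨x, hx⟩ :=
    exists_mul_eq_mul_companion (apply_one_zero_ne_zero_of_irreducible_charpoly hg)
  obtain ⟨y, hy⟩ :=
    exists_mul_eq_mul_companion (apply_one_zero_ne_zero_of_irreducible_charpoly (hgh ▸ hg))
  rw [Matrix.det_eq_sign_charpoly_coeff, Matrix.trace_eq_neg_charpoly_coeff, ← hgh,
    ← Matrix.det_eq_sign_charpoly_coeff, ← Matrix.trace_eq_neg_charpoly_coeff] at hy
  have hcompanion : x⁻¹ * g * x = y⁻¹ * h * y := by
    ext1
    simp only [Units.val_mul]
    rw [mul_assoc, hx, mul_assoc, hy, ← mul_assoc, ← mul_assoc, Units.inv_mul, Units.inv_mul]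
  refine isConj_iff.2 ⟨y * x⁻¹, ?_⟩
  calc y * x⁻¹ * g * (y * x⁻¹)⁻¹ = y * (x⁻¹ * g * x) * y⁻¹ := by group
    _ = h := by rw [hcompanion]; group

theorem orderOf_dvd_iff_dvd_X_pow_sub_one {A : Type*} [Ring A] [Algebra F A] [Nontrivial A]
    {f : F[X]} (hf : Irreducible f) (hm : f.Monic) {x : A} (hx : aeval x f = 0) {k : ℕ} :
    orderOf x ∣ k ↔ f ∣ X ^ k - 1 := by
  rw [minpoly.eq_of_irreducible_of_monic hf hx hm, minpoly.dvd_iff, orderOf_dvd_iff_pow_eq_one]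
  simp [sub_eq_zero]

theorem nonempty_of_irreducible_charpoly {M : Matrix n n F} (hM : Irreducible M.charpoly) :
    Nonempty n := by
  refine not_isEmpty_iff.1 fun _ => hM.not_isUnit ?_
  rw [Matrix.charpoly, Matrix.det_isEmpty]
  exact isUnit_one

theorem orderOf_dvd_iff_charpoly_dvd {g : GL n F} (hg : Irreducible g.val.charpoly) {k : ℕ} :
    orderOf g ∣ k ↔ g.val.charpoly ∣ X ^ k - 1 := by
  have := nonempty_of_irreducible_charpoly hg
  rw [← orderOf_units]
  exact orderOf_dvd_iff_dvd_X_pow_sub_one hg g.val.charpoly_monic g.val.aeval_self_charpoly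

theorem orderOf_dvd_card_pow_sub_one_iff [Finite F] {g : GL n F}
    (hg : Irreducible g.val.charpoly) {k : ℕ} :
    orderOf g ∣ Nat.card F ^ k - 1 ↔ Fintype.card n ∣ k := by
  have := nonempty_of_irreducible_charpoly hg
  have hcop : IsCoprime g.val.charpoly X := (hg.coprime_iff_not_dvd).2 fun ⟨q, hq⟩ => by
    have h0 := congrArg (aeval g.val) hq
    rw [map_mul, Matrix.aeval_self_charpoly, zero_mul, aeval_X] at h0
    exact g.ne_zero h0
  have hX : (X ^ Nat.card F ^ k - X : F[X]) = X * (X ^ (Nat.card F ^ k - 1) - 1) := by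
    rw [mul_sub, mul_one, ← pow_succ', Nat.sub_add_cancel (Nat.one_le_pow _ _ Nat.card_pos)]
  have hdvd : g.val.charpoly ∣ X ^ (Nat.card F ^ k - 1) - 1 ↔
      g.val.charpoly ∣ X ^ Nat.card F ^ k - X :=
    hX ▸ ⟨fun h => h.mul_left X, hcop.dvd_of_dvd_mul_left⟩
  rw [orderOf_dvd_iff_charpoly_dvd hg, hdvd, ← hg.natDegree_dvd_iff_dvd_X_pow_card_pow_sub_X,
    Matrix.charpoly_natDegree_eq_dim]

theorem exists_aeval_pow_charpoly_eq_zero {g h : GL n F} (hg : Irreducible g.val.charpoly)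
    (hh : Irreducible h.val.charpoly) (hfin : IsOfFinOrder h) (hgh : orderOf g = orderOf h) :
    ∃ k : ℕ, aeval (h.val ^ k) g.val.charpoly = 0 := by
  -- Roots `a` of `g.charpoly` and `b` of `h.charpoly` have equal order, so `a` is a power of `b`.
  have := nonempty_of_irreducible_charpoly hg
  have exists_root {g : GL n F} (hg : Irreducible g.val.charpoly) :
      ∃ a : AlgebraicClosure F, aeval a g.val.charpoly = 0 ∧ orderOf a = orderOf g := by
    obtain ⟨a, ha⟩ := IsAlgClosed.exists_aeval_eq_zero (AlgebraicClosure F) g.val.charpoly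
      hg.degree_pos.ne'
    exact ⟨a, ha, Nat.dvd_right_iff_eq.1 fun k => (orderOf_dvd_iff_dvd_X_pow_sub_one hg
      g.val.charpoly_monic ha).trans (orderOf_dvd_iff_charpoly_dvd hg).symm⟩
  obtain ⟨a, ha, hao⟩ := exists_root hg
  obtain ⟨b, hb, hbo⟩ := exists_root hh
  have : NeZero (orderOf b) := ⟨by rw [hbo]; exact hfin.orderOf_pos.ne'⟩
  obtain ⟨k, -, rfl⟩ := (IsPrimitiveRoot.orderOf b).eq_pow_of_pow_eq_one (ξ := a)
    (by rw [hbo, ← hgh, ← hao, pow_orderOf_eq_one])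
  have hdvd : h.val.charpoly ∣ g.val.charpoly.comp (X ^ k) := by
    rw [minpoly.eq_of_irreducible_of_monic hh hb h.val.charpoly_monic, minpoly.dvd_iff]
    simpa [aeval_comp] using ha
  obtain ⟨q, hq⟩ := hdvd
  exact ⟨k, by simpa [aeval_comp, h.val.aeval_self_charpoly] using congrArg (aeval h.val) hq⟩

theorem charpoly_eq_of_aeval_eq_zero {M N : Matrix n n F} (hM : Irreducible M.charpoly)
    (hN : aeval N M.charpoly = 0) : M.charpoly = N.charpoly := by
  have := nonempty_of_irreducible_charpoly hM
  have hmin := minpoly.eq_of_irreducible_of_monic hM hN M.charpoly_monic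
  refine eq_of_monic_of_associated M.charpoly_monic N.charpoly_monic
    (associated_of_dvd_of_natDegree_le (hmin ▸ N.minpoly_dvd_charpoly)
      N.charpoly_monic.ne_zero ?_)
  rw [Matrix.charpoly_natDegree_eq_dim, Matrix.charpoly_natDegree_eq_dim]

theorem exists_conj_zpowers_of_irreducible [Finite F] {g h : GL (Fin 2) F}
    (hg : Irreducible g.val.charpoly) (hh : Irreducible h.val.charpoly)
    (hgh : orderOf g = orderOf h) :
    ∃ x : GL (Fin 2) F,
      Subgroup.zpowers h = (Subgroup.zpowers g).map (MulAut.conj x).toMonoidHom := by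
  obtain ⟨k, hk⟩ := exists_aeval_pow_charpoly_eq_zero hg hh (isOfFinOrder_of_finite h) hgh
  obtain ⟨x, hx⟩ := isConj_iff.1 <| isConj_of_irreducible_of_charpoly_eq (h := h ^ k) hg <| by
    simpa using charpoly_eq_of_aeval_eq_zero hg hk
  have hxk : (MulAut.conj x).toMonoidHom g = h ^ k := hx
  refine ⟨x, Eq.symm ?_⟩
  rw [MonoidHom.map_zpowers, hxk]
  refine Subgroup.eq_of_le_of_card_ge (Subgroup.zpowers_le.2 (Subgroup.npow_mem_zpowers h k)) ?_
  rw [Nat.card_zpowers, Nat.card_zpowers, ← hxk, ← hgh]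
  exact (orderOf_injective _ (MulAut.conj x).injective g).ge

theorem isRoot_charpoly_leftMulMatrix_iff {L : Type*} [Field L] [Algebra F L]
    (b : Module.Basis n F L) {u : L} {χ : F} :
    (Algebra.leftMulMatrix b u).charpoly.IsRoot χ ↔ u = algebraMap F L χ := by
  have := Module.Finite.of_basis b
  have hscalar : Matrix.scalar n χ = Algebra.leftMulMatrix b (algebraMap F L χ) :=
    ((Algebra.leftMulMatrix b).commutes χ).symm
  rw [Polynomial.IsRoot, Matrix.eval_charpoly, hscalar, ← map_sub, ← Algebra.norm_eq_matrix_det,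
    Algebra.norm_eq_zero_iff, sub_eq_zero, eq_comm]

theorem exists_orderOf_eq_irreducible_charpoly [Finite F] {k : ℕ}
    (hk : k ∣ Nat.card F ^ 2 - 1) (hk' : ¬ k ∣ Nat.card F - 1) :
    ∃ g : GL (Fin 2) F, orderOf g = k ∧ Irreducible g.val.charpoly := by
  obtain ⟨p, hp⟩ := CharP.exists F
  have := Fact.mk (CharP.char_is_prime F p)
  let L := FiniteField.Extension F p 2
  let b : Module.Basis (Fin 2) F L :=
    Module.finBasisOfFinrankEq _ _ (FiniteField.finrank_extension F p 2)
  have hL : Nat.card Lˣ = Nat.card F ^ 2 - 1 := by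
    rw [Nat.card_units, FiniteField.natCard_extension]
  obtain ⟨u, rfl⟩ : ∃ u : Lˣ, orderOf u = k :=
    exists_orderOf_eq_of_isCyclic (hL ▸ hk)
  let φ : Lˣ →* GL (Fin 2) F := Units.map (Algebra.leftMulMatrix b : L →* _)
  refine ⟨φ u, orderOf_injective φ (Units.map_injective (Algebra.leftMulMatrix_injective b)) u,
    irreducible_charpoly_fin_two_iff.2 fun χ hχ => hk' ?_⟩
  have hu : (u : L) = algebraMap F L χ := (isRoot_charpoly_leftMulMatrix_iff b).1 hχ
  have hχ0 : χ ≠ 0 := by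
    rintro rfl
    exact u.ne_zero (hu.trans (map_zero _))
  have := Fintype.ofFinite F
  rw [orderOf_dvd_iff_pow_eq_one, Units.ext_iff, Units.val_pow_eq_pow_val, hu, ← map_pow,
    Nat.card_eq_fintype_card, FiniteField.pow_card_sub_one_eq_one χ hχ0, map_one, Units.val_one]

theorem charpoly_dvd_of_splits [Finite F] {g : GL n F} (hg : g.val.charpoly.Splits) :
    g.val.charpoly ∣ (X ^ (Nat.card F - 1) - 1) ^ Fintype.card n := by
  have := Fintype.ofFinite F
  have hdvd : ∀ χ ∈ g.val.charpoly.roots, X - C χ ∣ (X ^ (Nat.card F - 1) - 1 : F[X]) := by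
    intro χ hχ
    have hχ0 : χ ≠ 0 := by
      rintro rfl
      obtain ⟨v, hv, hgv⟩ := isRoot_charpoly_iff.1 (isRoot_of_mem_roots hχ)
      rw [zero_smul] at hgv
      exact hv (Matrix.eq_zero_of_mulVec_eq_zero
        ((Matrix.isUnit_iff_isUnit_det _).1 g.isUnit).ne_zero hgv)
    rw [dvd_iff_isRoot]
    simp [FiniteField.pow_card_sub_one_eq_one χ hχ0]
  have hprod := Multiset.prod_dvd_prod_of_dvd _ _ hdvd
  rwa [← hg.eq_prod_roots_of_monic g.val.charpoly_monic, Multiset.map_const',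
    Multiset.prod_replicate, ← hg.natDegree_eq_card_roots, Matrix.charpoly_natDegree_eq_dim]
    at hprod

theorem pow_eq_one_of_charpoly_splits [Finite F] {p : ℕ} [Fact p.Prime] [CharP F p] {g : GL n F}
    (hn : Fintype.card n ≤ p) (hg : g.val.charpoly.Splits) :
    g ^ ((Nat.card F - 1) * p) = 1 := by
  have hfrob : (X ^ ((Nat.card F - 1) * p) - 1 : F[X]) = (X ^ (Nat.card F - 1) - 1) ^ p := by
    rw [sub_pow_char, one_pow, pow_mul]
  obtain ⟨q, hq⟩ := hfrob ▸ (charpoly_dvd_of_splits hg).trans (pow_dvd_pow _ hn)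
  have h0 := congrArg (aeval g.val) hq
  rw [map_mul, Matrix.aeval_self_charpoly, zero_mul] at h0
  ext1
  simpa [sub_eq_zero] using h0

end Charpoly

/-! ### Reducible and irreducible abelian subgroups of `GL(2, p)` -/

section Reducible

open Polynomial

variable {p : ℕ} [Fact p.Prime] {K : Subgroup (GL (Fin 2) (ZMod p))}

theorem isReducibleSubgroup_iff_exists_eigenvector :
    IsReducibleSubgroup K ↔
      ∃ v ≠ 0, ∀ g ∈ K, ∃ χ : ZMod p, g.val.mulVec v = χ • v := by
  constructor
  · rintro ⟨W, hbot, htop, hW⟩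
    obtain ⟨v, hv, hv0⟩ := (Submodule.ne_bot_iff W).1 hbot
    have hrank : Module.finrank (ZMod p) W = 1 := by
      have hlt : Module.finrank (ZMod p) W < 2 := by simpa using Submodule.finrank_lt htop
      have hne : Module.finrank (ZMod p) W ≠ 0 := fun h => hbot (Submodule.finrank_eq_zero.1 h)
      lia
    refine ⟨v, hv0, fun g hg => ?_⟩
    obtain ⟨χ, hχ⟩ := (finrank_eq_one_iff_of_nonzero' (⟨v, hv⟩ : W)
      (fun h => hv0 (congrArg Subtype.val h))).1 hrank ⟨_, hW g hg v hv⟩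
    exact ⟨χ, (congrArg Subtype.val hχ).symm⟩
  · rintro ⟨v, hv0, hv⟩
    refine ⟨Submodule.span _ {v}, by simpa using hv0, fun htop => ?_, fun g hg w hw => ?_⟩
    · have hrank := finrank_span_singleton (K := ZMod p) hv0
      rw [htop, finrank_top] at hrank
      simp at hrank
    · obtain ⟨a, rfl⟩ := Submodule.mem_span_singleton.1 hw
      obtain ⟨χ, hχ⟩ := hv g hg
      rw [Matrix.mulVec_smul, hχ]
      exact Submodule.smul_mem _ _ (Submodule.smul_mem _ _ (Submodule.mem_span_singleton_self v))

theorem isReducibleSubgroup_zpowers_iff {g : GL (Fin 2) (ZMod p)} :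
    IsReducibleSubgroup (Subgroup.zpowers g) ↔ ¬ Irreducible g.val.charpoly := by
  rw [isReducibleSubgroup_iff_exists_eigenvector, irreducible_charpoly_fin_two_iff]
  push Not
  simp only [isRoot_charpoly_iff]
  constructor
  · rintro ⟨v, hv0, hv⟩
    obtain ⟨χ, hχ⟩ := hv g (Subgroup.mem_zpowers g)
    exact ⟨χ, v, hv0, hχ⟩
  · rintro ⟨χ, v, hv0, hv⟩
    refine ⟨v, hv0, fun x hx => ?_⟩
    obtain ⟨k, rfl⟩ := (isOfFinOrder_of_finite g).mem_powers_iff_mem_zpowers.2 hx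
    refine ⟨χ ^ k, ?_⟩
    clear hx
    induction k with
    | zero => simp
    | succ k ih =>
      simp only at ih ⊢
      rw [pow_succ', Units.val_mul, ← Matrix.mulVec_mulVec, ih, Matrix.mulVec_smul, hv, smul_smul,
        pow_succ]

namespace IsReducibleSubgroup

theorem map_conj (hK : IsReducibleSubgroup K) (g : GL (Fin 2) (ZMod p)) :
    IsReducibleSubgroup (K.map (MulAut.conj g).toMonoidHom) := by
  rw [isReducibleSubgroup_iff_exists_eigenvector] at hK ⊢
  obtain ⟨v, hv0, hv⟩ := hK
  refine ⟨g.val.mulVec v, fun h => hv0 ?_, ?_⟩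
  · exact Matrix.mulVec_injective_iff_isUnit.2 g.isUnit (h.trans (Matrix.mulVec_zero _).symm)
  · rintro _ ⟨x, hx, rfl⟩
    obtain ⟨χ, hχ⟩ := hv x hx
    refine ⟨χ, ?_⟩
    simp only [MulEquiv.coe_toMonoidHom, MulAut.conj_apply, Matrix.mulVec_mulVec, ← Units.val_mul,
      inv_mul_cancel_right]
    rw [Units.val_mul, ← Matrix.mulVec_mulVec, hχ, Matrix.mulVec_smul]

theorem pow_eq_one (hK : IsReducibleSubgroup K) (hcop : (Nat.card K).Coprime p) (x : K) :
    x ^ (p - 1) = 1 := by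
  obtain ⟨v, hv0, hv⟩ := isReducibleSubgroup_iff_exists_eigenvector.1 hK
  obtain ⟨χ, hχ⟩ := hv x x.2
  have hsplits : (x : GL (Fin 2) (ZMod p)).val.charpoly.Splits :=
    Splits.of_natDegree_eq_two (by simp [Matrix.charpoly_natDegree_eq_dim])
      (isRoot_charpoly_iff.2 ⟨v, hv0, hχ⟩)
  have hpow : (x ^ (p - 1)) ^ p = 1 := Subtype.ext <| by
    simpa [pow_mul] using pow_eq_one_of_charpoly_splits (p := p)
      (by simpa using (Fact.out : p.Prime).two_le) hsplits
  exact eq_one_of_pow_eq_one_of_coprime hcop pow_card_eq_one' hpow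

end IsReducibleSubgroup

theorem mulVec_injective_of_commute (hK : ¬ IsReducibleSubgroup K)
    {M : Matrix (Fin 2) (Fin 2) (ZMod p)} (hM : M ≠ 0) (hcomm : ∀ g ∈ K, M * g.val = g.val * M) :
    Function.Injective M.mulVec := by
  rw [← Matrix.coe_mulVecLin, ← LinearMap.ker_eq_bot]
  by_contra hbot
  refine hK ⟨LinearMap.ker M.mulVecLin, hbot, fun htop => hM ?_, fun g hg v hv => ?_⟩
  · exact Matrix.toLin'.injective ((LinearMap.ker_eq_top.1 htop).trans (map_zero _).symm)
  · rw [LinearMap.mem_ker, Matrix.mulVecLin_apply] at hv ⊢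
    rw [Matrix.mulVec_mulVec, hcomm g hg, ← Matrix.mulVec_mulVec, hv, Matrix.mulVec_zero]

-- By Schur's lemma `K` generates a commutative domain of matrices.
open scoped IsMulCommutative in
theorem isCyclic_of_not_isReducibleSubgroup [IsMulCommutative K] (hK : ¬ IsReducibleSubgroup K) :
    IsCyclic K := by
  let S : Set (Matrix (Fin 2) (Fin 2) (ZMod p)) := Units.val '' (K : Set (GL (Fin 2) (ZMod p)))
  have := Algebra.isMulCommutative_adjoin (ZMod p) (s := S) <| by
    rintro _ ⟨x, hx, rfl⟩ _ ⟨y, hy, rfl⟩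
    exact congrArg Units.val (congrArg Subtype.val (mul_comm' (⟨x, hx⟩ : K) ⟨y, hy⟩))
  let R := Algebra.adjoin (ZMod p) S
  let f : K →* R :=
    { toFun := fun x => ⟨x.1.val, Algebra.subset_adjoin ⟨x, x.2, rfl⟩⟩
      map_one' := rfl
      map_mul' := fun _ _ => rfl }
  have : NoZeroDivisors R := ⟨fun {x y} hxy => or_iff_not_imp_left.2 fun hx => by
    have hinj := mulVec_injective_of_commute hK (M := x.1) (fun h => hx (Subtype.ext h))
      fun g hg => congrArg Subtype.val (mul_comm x (f ⟨g, hg⟩))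
    have hxy0 : x.1 * y.1 = 0 := congrArg Subtype.val hxy
    refine Subtype.ext (Matrix.toLin'.injective (LinearMap.ext fun v => hinj ?_))
    change x.1.mulVec (y.1.mulVec v) = x.1.mulVec (Matrix.toLin' 0 v)
    rw [Matrix.mulVec_mulVec, hxy0, map_zero, LinearMap.zero_apply, Matrix.mulVec_zero,
      Matrix.zero_mulVec]⟩
  have : IsDomain R := NoZeroDivisors.to_isDomain R
  exact isCyclic_of_injective_ringHom f fun x y h =>
    Subtype.ext (Units.ext (congrArg Subtype.val h))

theorem exists_zpowers_eq_of_not_isReducibleSubgroup [IsMulCommutative K]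
    (hK : ¬ IsReducibleSubgroup K) :
    ∃ g : GL (Fin 2) (ZMod p), Subgroup.zpowers g = K ∧ Irreducible g.val.charpoly := by
  obtain ⟨g, rfl⟩ := (Subgroup.isCyclic_iff_exists_zpowers_eq_top K).1
    (isCyclic_of_not_isReducibleSubgroup hK)
  exact ⟨g, rfl, by_contra fun hg => hK (isReducibleSubgroup_zpowers_iff.2 hg)⟩

end Reducible

/-! ### Automorphism groups -/

/-- The automorphisms of a `ZMod n`-module are the automorphisms of its underlying group. -/
def linearEquivMulEquivMulAut (n : ℕ) (M : Type*) [AddCommGroup M] [Module (ZMod n) M] :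
    (M ≃ₗ[ZMod n] M) ≃* MulAut (Multiplicative M) where
  toFun e := AddEquiv.toMultiplicative e.toAddEquiv
  invFun f := (AddEquiv.toMultiplicative.symm f).toLinearEquiv (ZMod.map_smul _)
  left_inv _ := rfl
  right_inv _ := rfl
  map_mul' _ _ := rfl

/-- `GL(2, n)` as the full automorphism group of `Cyc n × Cyc n`. -/
def glMulEquivMulAutCycProdCyc (n : ℕ) : GL (Fin 2) (ZMod n) ≃* MulAut (Cyc n × Cyc n) :=
  ((Matrix.GeneralLinearGroup.toLin.trans
    (LinearMap.GeneralLinearGroup.generalLinearEquiv _ _)).trans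
      (linearEquivMulEquivMulAut n (Fin 2 → ZMod n))).trans
        (MulAut.congr ((AddEquiv.toMultiplicative
          (LinearEquiv.finTwoArrow (ZMod n) (ZMod n)).toAddEquiv).trans
            (MulEquiv.prodMultiplicative _ _)))

/-- The units of `ZMod n`, acting by multiplication, as the full automorphism group of `Cyc n`. -/
def unitsMulEquivMulAutCyc (n : ℕ) : (ZMod n)ˣ ≃* MulAut (Cyc n) :=
  ((MulAutMultiplicative (ZMod n)).trans (ZMod.AddAutEquivUnits n).toMultiplicative).symm

/-! ### Counting conjugacy classes of images -/

theorem mem_divisors_gcd_iff {k n t : ℕ} (hk : k ≠ 0) :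
    t ∈ (k.gcd n).divisors ↔ t ∣ k ∧ t ∣ n := by
  rw [Nat.mem_divisors, Nat.dvd_gcd_iff, and_iff_left (Nat.gcd_ne_zero_left hk)]

section GeneralLinearGroup

variable {p : ℕ} [Fact p.Prime]

theorem numConjClasses_reducible_homImages {c d : ℕ} [NeZero c] (hcd : c.Coprime d)
    (hd : Squarefree d) (hpQ : (Nat.card (Cyc (c * d) × Cyc d)).Coprime p)
    {H : ℕ → Subgroup (Cyc (c * d) × Cyc d)}
    (hH : ∀ t ∈ ((c * d).gcd (p - 1) * d.gcd (p - 1)).divisors, Nat.card (H t) = t) :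
    numConjClasses {K ∈ homImages (Cyc (c * d) × Cyc d) (GL (Fin 2) (ZMod p)) |
        IsReducibleSubgroup K} =
      ∑ t ∈ ((c * d).gcd (p - 1) * d.gcd (p - 1)).divisors, Nred p (H t) := by
  have hcd0 : c * d ≠ 0 := mul_ne_zero (NeZero.ne c) hd.ne_zero
  have hlm0 := mul_ne_zero (Nat.gcd_ne_zero_left (n := p - 1) hcd0)
    (Nat.gcd_ne_zero_left (n := p - 1) hd.ne_zero)
  rw [numConjClasses_eq_sum_card (T := ((c * d).gcd (p - 1) * d.gcd (p - 1)).divisors) <| by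
    rintro K ⟨hK, hred⟩
    have hdec := (mem_homImages_iff_hasCycDecomposition hcd hd K).1 hK
    have hpow := hred.pow_eq_one (coprime_card_of_mem_homImages hpQ hK)
    exact Nat.mem_divisors.2 ⟨hdec.card_dvd hcd hpow, hlm0⟩]
  refine Finset.sum_congr rfl fun t ht => ?_
  rw [Nred_eq_numConjClasses]
  congr 1
  ext K
  have hHt := hasCycDecomposition_subgroup hcd hd (H t)
  constructor
  · rintro ⟨⟨hK, hred⟩, hcard⟩
    exact ⟨hred, ((mem_homImages_iff_hasCycDecomposition hcd hd K).1 hK).nonempty_mulEquiv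
      (NeZero.ne c) hcd hd hHt (hcard.trans (hH t ht).symm)⟩
  · rintro ⟨hred, ⟨e⟩⟩
    exact ⟨⟨(mem_homImages_iff_hasCycDecomposition hcd hd K).2 (hHt.congr e.symm), hred⟩,
      (Nat.card_congr e.toEquiv).trans (hH t ht)⟩

theorem numConjClasses_irreducible_homImages {k d : ℕ} (hk : k ≠ 0) (hdk : d ∣ k) :
    numConjClasses {K ∈ homImages (Cyc k × Cyc d) (GL (Fin 2) (ZMod p)) |
        ¬ IsReducibleSubgroup K} =
      ((k.gcd (p ^ 2 - 1)).divisors \ (k.gcd (p - 1)).divisors).card := by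
  have exists_generator : ∀ K ∈ homImages (Cyc k × Cyc d) (GL (Fin 2) (ZMod p)),
      ¬ IsReducibleSubgroup K → ∃ g, Subgroup.zpowers g = K ∧ Irreducible g.val.charpoly := by
    rintro _ ⟨φ, rfl⟩
    exact exists_zpowers_eq_of_not_isReducibleSubgroup
  have orderOf_dvd {g : GL (Fin 2) (ZMod p)} (hg : Irreducible g.val.charpoly) (j : ℕ) :
      orderOf g ∣ p ^ j - 1 ↔ 2 ∣ j := by
    simpa using orderOf_dvd_card_pow_sub_one_iff hg (k := j)
  refine numConjClasses_eq_card ?_ fun t => ?_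
  · rintro K ⟨hK, hKirr⟩ L ⟨hL, hLirr⟩ h
    obtain ⟨g, rfl, hg⟩ := exists_generator K hK hKirr
    obtain ⟨g', rfl, hg'⟩ := exists_generator L hL hLirr
    rw [Nat.card_zpowers, Nat.card_zpowers] at h
    exact exists_conj_zpowers_of_irreducible hg hg' h
  · rw [Finset.mem_sdiff, mem_divisors_gcd_iff hk, mem_divisors_gcd_iff hk]
    constructor
    · rintro ⟨⟨htk, ht2⟩, ht1⟩
      obtain ⟨g, rfl, hg⟩ := exists_orderOf_eq_irreducible_charpoly (F := ZMod p) (k := t)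
        (by simpa using ht2) (by simpa using fun h => ht1 ⟨htk, h⟩)
      refine ⟨Subgroup.zpowers g, ⟨?_, ?_⟩, Nat.card_zpowers g⟩
      · rwa [mem_homImages_cyc_prod_cyc_iff_of_isCyclic hdk, Nat.card_zpowers]
      · rwa [isReducibleSubgroup_zpowers_iff, not_not]
    · rintro ⟨K, ⟨hK, hKirr⟩, rfl⟩
      obtain ⟨g, rfl, hg⟩ := exists_generator K hK hKirr
      have hgk := (mem_homImages_cyc_prod_cyc_iff_of_isCyclic hdk _).1 hK
      rw [Nat.card_zpowers] at hgk ⊢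
      have h1 := (orderOf_dvd hg 1).not.2 (by norm_num)
      rw [pow_one] at h1
      exact ⟨⟨hgk, (orderOf_dvd hg 2).2 dvd_rfl⟩, fun h => h1 h.2⟩

end GeneralLinearGroup

theorem coprime_gcd_sub_one_gcd_add_one {k : ℕ} (hk : Odd k) (n : ℕ) :
    (k.gcd (n - 1)).Coprime (k.gcd (n + 1)) := by
  set r := (k.gcd (n - 1)).gcd (k.gcd (n + 1))
  have hr : r ∣ n + 1 - (n - 1) := Nat.dvd_sub
    ((Nat.gcd_dvd_right _ _).trans (Nat.gcd_dvd_right _ _))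
    ((Nat.gcd_dvd_left _ _).trans (Nat.gcd_dvd_right _ _))
  have hr2 : r ∣ 2 := hr.trans <| by
    rcases n with _ | n
    · simp
    · rw [show n + 1 + 1 - (n + 1 - 1) = 2 by lia]
  have hrk : r ∣ k := (Nat.gcd_dvd_left _ _).trans (Nat.gcd_dvd_left _ _)
  exact Nat.eq_one_of_dvd_coprimes (Nat.coprime_two_left.2 hk) hr2 hrk

theorem gcd_sq_sub_one {k : ℕ} (hk : Odd k) (n : ℕ) :
    k.gcd (n ^ 2 - 1) = k.gcd (n - 1) * k.gcd (n + 1) := by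
  have hsq : n ^ 2 - 1 = (n - 1) * (n + 1) := by
    simpa [mul_comm] using Nat.sq_sub_sq n 1
  rw [hsq]
  exact Nat.dvd_antisymm (Nat.gcd_mul_right_dvd_mul_gcd _ _ _) <| Nat.dvd_gcd
    ((coprime_gcd_sub_one_gcd_add_one hk n).mul_dvd_of_dvd_of_dvd (Nat.gcd_dvd_left _ _)
      (Nat.gcd_dvd_left _ _))
    (mul_dvd_mul (Nat.gcd_dvd_right _ _) (Nat.gcd_dvd_right _ _))

theorem card_divisors_mul_sdiff_divisors {l s : ℕ} (hl : l ≠ 0) (hs : s ≠ 0)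
    (hls : l.Coprime s) : ((l * s).divisors \ l.divisors).card = Omega s l := by
  rw [Finset.card_sdiff_of_subset
      (Nat.divisors_subset_of_dvd (mul_ne_zero hl hs) (dvd_mul_right l s)),
    hls.card_divisors_mul, Omega]
  split_ifs with h
  · simp [h]
  · rw [tau, tau, Nat.mul_sub, mul_one]

theorem card_divisors_gcd_sq_sub_one_sdiff {k : ℕ} (hk : Odd k) (n : ℕ) :
    ((k.gcd (n ^ 2 - 1)).divisors \ (k.gcd (n - 1)).divisors).card =
      Omega (k.gcd (n + 1)) (k.gcd (n - 1)) := by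
  rw [gcd_sq_sub_one hk]
  exact card_divisors_mul_sdiff_divisors (Nat.gcd_ne_zero_left hk.pos.ne')
    (Nat.gcd_ne_zero_left hk.pos.ne') (coprime_gcd_sub_one_gcd_add_one hk n)

theorem eq_of_card_eq_of_isCyclic {G : Type*} [CommGroup G] [Finite G] [IsCyclic G]
    {K L : Subgroup G} (h : Nat.card K = Nat.card L) : K = L := by
  have eq_ker (K : Subgroup G) : K = (powMonoidHom (Nat.card K) : G →* G).ker := by
    refine Subgroup.eq_of_le_of_card_ge (fun x hx => ?_) ?_
    · exact congrArg Subtype.val (pow_card_eq_one' (x := (⟨x, hx⟩ : K)))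
    · rw [IsCyclic.card_powMonoidHom_ker]
      exact Nat.gcd_le_right _ Nat.card_pos
  rw [eq_ker K, h, ← eq_ker L]

theorem numConjClasses_homImages_of_isCyclic {A : Type*} [CommGroup A] [Finite A] [IsCyclic A]
    {k d : ℕ} (hk : k ≠ 0) (hdk : d ∣ k) :
    numConjClasses (homImages (Cyc k × Cyc d) A) = tau (k.gcd (Nat.card A)) := by
  refine numConjClasses_eq_card (fun K _ L _ h => ⟨1, ?_⟩) fun t => ?_
  · rw [eq_of_card_eq_of_isCyclic h]
    ext
    simp
  · simp only [mem_homImages_cyc_prod_cyc_iff_of_isCyclic hdk, mem_divisors_gcd_iff hk]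
    constructor
    · rintro ⟨htk, htA⟩
      obtain ⟨K, rfl⟩ := exists_subgroup_card_eq_of_isCyclic htA
      exact ⟨K, htk, rfl⟩
    · rintro ⟨K, hK, rfl⟩
      exact ⟨hK, Subgroup.card_subgroup_dvd_card K⟩

theorem numConjClasses_homImages_of_coprime {Q A : Type*} [Group Q] [Group A]
    (h : (Nat.card Q).Coprime (Nat.card A)) : numConjClasses (homImages Q A) = 1 := by
  have himages {K : Subgroup A} (hK : K ∈ homImages Q A) : K = ⊥ :=
    Subgroup.eq_bot_of_card_eq K <| Nat.eq_one_of_dvd_coprimes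
      (coprime_card_of_mem_homImages h hK) dvd_rfl (Subgroup.card_subgroup_dvd_card K)
  refine numConjClasses_eq_card (T := {1}) (fun K hK L hL _ => ⟨1, ?_⟩) fun t => ?_
  · rw [himages hK, himages hL, Subgroup.map_bot]
  · rw [Finset.mem_singleton]
    constructor
    · rintro rfl
      exact ⟨⊥, ⟨1, MonoidHom.range_one⟩, Subgroup.card_bot⟩
    · rintro ⟨K, hK, rfl⟩
      rw [himages hK, Subgroup.card_bot]

theorem coprime_card_cyc_prod_cyc {n k d : ℕ} (hdk : d ∣ k) (h : n.Coprime k) :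
    n.Coprime (Nat.card (Cyc k × Cyc d)) := by
  rw [Nat.card_prod, card_cyc, card_cyc]
  exact h.mul_right (h.coprime_dvd_right hdk)

theorem numConjClasses_homImages_units_zmod {k d p α : ℕ} (hk : k ≠ 0) (hdk : d ∣ k)
    (hp : p.Prime) (hpk : k.Coprime p) (hα : 1 ≤ α) :
    numConjClasses (homImages (Cyc k × Cyc d) (ZMod (p ^ α))ˣ) = tau (k.gcd (p - 1)) := by
  have : NeZero (p ^ α) := ⟨pow_ne_zero _ hp.ne_zero⟩
  have hcard : Nat.card (ZMod (p ^ α))ˣ = p ^ (α - 1) * (p - 1) := by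
    rw [Nat.card_eq_fintype_card, ZMod.card_units_eq_totient, Nat.totient_prime_pow hp hα]
  rcases eq_or_ne p 2 with rfl | h2
  · have hcop : (Nat.card (Cyc k × Cyc d)).Coprime (Nat.card (ZMod (2 ^ α))ˣ) := by
      rw [hcard]
      simpa using (coprime_card_cyc_prod_cyc hdk hpk.symm).symm.pow_right (α - 1)
    rw [numConjClasses_homImages_of_coprime hcop]
    simp [tau]
  · have := ZMod.isCyclic_units_of_prime_pow p hp h2 α
    rw [numConjClasses_homImages_of_isCyclic hk hdk, hcard,
      (hpk.symm.pow_left _).gcd_mul_left_cancel_right]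

theorem theorem1p3_general (p c d l m s : ℕ) (hp : p.Prime) (hc : Odd c) (hd : Odd d)
    (hpcd : ¬ p ∣ c * d) (hsq : Squarefree d) (hcop : Nat.gcd c d = 1)
    (hl : l = Nat.gcd (c * d) (p - 1)) (hm : m = Nat.gcd d (p - 1))
    (hs : s = Nat.gcd (c * d) (p + 1)) :
    ((∀ t ∈ (l * m).divisors, ∃ H : Subgroup (Cyc (c * d) × Cyc d), Nat.card H = t) ∧
      (∀ H₁ H₂ : Subgroup (Cyc (c * d) × Cyc d),
        Nat.card H₁ = Nat.card H₂ → Nonempty (H₁ ≃* H₂)) ∧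
      ∀ H : ℕ → Subgroup (Cyc (c * d) × Cyc d),
        (∀ t ∈ (l * m).divisors, Nat.card (H t) = t) →
        numSplitExtensions (Cyc p × Cyc p) (Cyc (c * d) × Cyc d)
          = ∑ t ∈ (l * m).divisors, Nred p (H t) + Omega s l) ∧
    (∀ α : ℕ, 1 ≤ α →
      numSplitExtensions (Cyc (p ^ α)) (Cyc (c * d) × Cyc d) = tau l) := by
  subst hl hm hs
  have := Fact.mk hp
  have : NeZero c := ⟨hc.pos.ne'⟩
  have : NeZero d := ⟨hd.pos.ne'⟩
  have hdk : d ∣ c * d := dvd_mul_left d c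
  have hpk := hp.coprime_iff_not_dvd.2 hpcd
  have hpQ := coprime_card_cyc_prod_cyc hdk hpk
  have hQ (A : Type) [Group A] := rangeDeterminesHom_cyc_prod_cyc hcop hsq A
  refine ⟨⟨fun t ht => ?_, fun _ _ => nonempty_subgroup_mulEquiv_of_card_eq hcop hsq,
    fun H hH => ?_⟩, fun α hα => ?_⟩
  · refine exists_subgroup_prod_card_eq ((Nat.dvd_of_mem_divisors ht).trans ?_)
    rw [card_cyc, card_cyc]
    exact mul_dvd_mul (Nat.gcd_dvd_left _ _) (Nat.gcd_dvd_left _ _)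
  · have hpN := (coprime_card_cyc_prod_cyc dvd_rfl hpQ.symm).symm
    rw [numSplitExtensions_eq_numConjClasses hpN (glMulEquivMulAutCycProdCyc p) (hQ _),
      numConjClasses_eq_add (R := IsReducibleSubgroup) _ fun _ g hK => hK.map_conj g,
      numConjClasses_reducible_homImages hcop hsq hpQ.symm hH,
      numConjClasses_irreducible_homImages (NeZero.ne _) hdk,
      card_divisors_gcd_sq_sub_one_sdiff (hc.mul hd)]
  · rw [numSplitExtensions_eq_numConjClasses (by rw [card_cyc]; exact hpQ.pow_left α)
      (unitsMulEquivMulAutCyc (p ^ α)) (hQ _),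
      numConjClasses_homImages_units_zmod (NeZero.ne _) hdk hp hpk.symm hα]

theorem theorem1p3 (p c d l m s : ℕ) (hp : p.Prime) (hc : Odd c) (hd : Odd d)
    (hpcd : ¬ p ∣ c * d) (hcube : ∀ r : ℕ, r.Prime → ¬ r ^ 3 ∣ c) (hsq : Squarefree d)
    (hcop : Nat.gcd c d = 1)
    (hl : l = Nat.gcd (c * d) (p - 1)) (hm : m = Nat.gcd d (p - 1))
    (hs : s = Nat.gcd (c * d) (p + 1)) :
    -- up to isomorphism there is exactly one subgroup of `Q` of each order `t ∣ l * m`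
    ((∀ t ∈ (l * m).divisors, ∃ H : Subgroup (Cyc (c * d) × Cyc d), Nat.card H = t) ∧
      (∀ H₁ H₂ : Subgroup (Cyc (c * d) × Cyc d),
        Nat.card H₁ = Nat.card H₂ → Nonempty (H₁ ≃* H₂)) ∧
      -- part (i), with `H t` any subgroup of `Q` of order `t`
      ∀ H : ℕ → Subgroup (Cyc (c * d) × Cyc d),
        (∀ t ∈ (l * m).divisors, Nat.card (H t) = t) →
        numSplitExtensions (Cyc p × Cyc p) (Cyc (c * d) × Cyc d)
          = ∑ t ∈ (l * m).divisors, Nred p (H t) + Omega s l) ∧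
    -- part (ii)
    (∀ α : ℕ, 1 ≤ α →
      numSplitExtensions (Cyc (p ^ α)) (Cyc (c * d) × Cyc d) = tau l) :=
  theorem1p3_general p c d l m s hp hc hd hpcd hsq hcop hl hm hs
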